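/- Let $d\ge 1$ be an integer and $0<q<\infty$. Let $B_d=\{z\in\mathbb{C}^d: |z|<1\}$ be the open unit ball of $\mathbb{C}^d$ with respect to the Euclidean norm, let $\mathcal{H}ol(B_d)$ be the space of holomorphic functions on $B_d$, and let $\nu$ be the volume (Lebesgue) measure on $B_d$, normalized so that $\nu(B_d)=1$. A weight is a continuous non-decreasing function $w:[0,1)\to(0,+\infty)$; a weight $w$ is log-convex if $\log w(r)$ is a convex function of $\log r$ for $0<r<1$. For real-valued functions $u,v$ on a set $X$, write $u\asymp v$ on $X$ (and say that $u$ and $v$ are equivalent) if there are constants $C_1,C_2>0$ such that $C_1u(x)\le v(x)\le C_2u(x)$ for all $x\in X$. Let $w:[0,1)\to(0,+\infty)$ be a weight. Then the following properties are equivalent: (i) $w$ is equivalent on $[0,1)$ to a log-convex weight; (ii) there exists $f\in\mathcal{H}ol(B_d)$ such that $$\left(\frac{1}{\nu(rB_d)}\int_{rB_d}|f(z)|^q\,d\nu(z)\right)^{1/q}\asymp w(r),\qquad 0<r<1.$$ -/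

import Mathlib

open MeasureTheory

noncomputable section

/-- A weight: a continuous, non-decreasing, strictly positive function on `[0, 1)`. (Values of `w`
outside `[0, 1)` play no role.) -/
structure IsWeight (w : ℝ → ℝ) : Prop where
  pos : ∀ r ∈ Set.Ico (0 : ℝ) 1, 0 < w r
  continuousOn : ContinuousOn w (Set.Ico 0 1)
  monotoneOn : MonotoneOn w (Set.Ico 0 1)

/-- A log-convex weight: `log w(r)` is a convex function of `t = log r`, for `0 < r < 1`. -/
structure IsLogConvexWeight (w : ℝ → ℝ) : Prop extends IsWeight w where
  convexOn_log : ConvexOn ℝ (Set.Iio 0) (fun t => Real.log (w (Real.exp t)))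

/-- `u ≍ v` on `X`: `C₁ u ≤ v ≤ C₂ u` on `X`, with constants `C₁, C₂ > 0`. -/
def EquivalentOn (X : Set ℝ) (u v : ℝ → ℝ) : Prop :=
  ∃ C₁ C₂ : ℝ, 0 < C₁ ∧ 0 < C₂ ∧ ∀ x ∈ X, C₁ * u x ≤ v x ∧ v x ≤ C₂ * u x

/-- The complex Euclidean space `ℂ^d`. -/
abbrev CSpace (d : ℕ) : Type := EuclideanSpace ℂ (Fin d)

/-- The open ball `r B_d` of radius `r` centred at the origin of `ℂ^d`. -/
def cBall (d : ℕ) (r : ℝ) : Set (CSpace d) := Metric.ball 0 r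

/-- `f` is holomorphic on the unit ball `B_d`. -/
def IsHolomorphicOnBall (d : ℕ) (f : CSpace d → ℂ) : Prop :=
  DifferentiableOn ℂ f (cBall d 1)

/-- The normalized volume measure `ν` on `B_d`: Lebesgue measure of `ℂ^d` restricted to `B_d` and
divided by the volume of `B_d`. -/
def normalizedVolume (d : ℕ) : Measure (CSpace d) :=
  ((volume : Measure (CSpace d)) (cBall d 1))⁻¹ • (volume : Measure (CSpace d)).restrict (cBall d 1)

/-- The volume integral mean `(ν(r B_d)⁻¹ ∫_{r B_d} |f|^q dν)^(1/q)`. -/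
def volumeMean (d : ℕ) (q : ℝ) (f : CSpace d → ℂ) (r : ℝ) : ℝ :=
  ((1 / (normalizedVolume d).real (cBall d r)) *
    ∫ z in cBall d r, ‖f z‖ ^ q ∂(normalizedVolume d)) ^ (1 / q)

end

/-! Scaling turns the mean over `r B_d` into the `1/q`-th power of N(r) = ∫ |f(r z)|^q dν(z), over
the unit ball.

From f to a log-convex weight: ν is rotation invariant, so N(|e^ζ|) depends only on t = Re ζ. For
real c, the function e^{ct} N(e^t) integrates |e^{cζ/q} f(e^ζ z)|^q over z, and |g|^q has the
sub-mean value property for analytic g. Hence e^{ct} N(e^t) obeys the maximum principle in t for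
every c, so log N(e^t) is convex (`convexOn_log_dilationIntegral`). Boundedness near t = -∞ makes it
nondecreasing, and N^{1/q} is the desired weight.

From a log-convex weight v to f: if v is bounded, f = 1 works. Otherwise Φ(t) = log v(e^t) is, near
t = 0, within a constant of the upper envelope of sparsely chosen supporting lines with integer
slopes (`exists_index`). Exponentiated, v(r) is comparable to the larger of two consecutive
monomials b_k r^{n_k}, and the others are geometrically smaller (`exists_separated_monomials`). Let
f be the sum of b_k z_i^{n_k}, each monomial normalized in L^q of the ball. A quasi-triangle
inequality, valid for every q > 0, bounds the mean above. For the lower bound, subtracting a rotated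
copy of f cancels one of the two dominant terms and doubles the other (`two_sided`). -/

/-! ### Sub-mean values and a one-dimensional maximum principle. -/

open Metric Filter Real in
/-- The sub-mean value property of `‖g‖ ^ q`, from Jensen's formula and `1 + x ≤ exp x`. -/
theorem norm_rpow_le_circleAverage {g : ℂ → ℂ} {c : ℂ} {R q : ℝ} (hR : 0 < R) (hq : 0 < q)
    (hg : AnalyticOnNhd ℂ g (closedBall c R)) :
    ‖g c‖ ^ q ≤ circleAverage (fun z => ‖g z‖ ^ q) c R := by
  have hRabs : |R| = R := abs_of_pos hR
  have hcont : ContinuousOn (fun z => ‖g z‖ ^ q) (sphere c |R|) := by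
    rw [hRabs]
    exact ((hg.continuousOn.mono sphere_subset_closedBall).norm).rpow_const
      (fun _ _ => Or.inr hq.le)
  have hint : CircleIntegrable (fun z => ‖g z‖ ^ q) c R := hcont.circleIntegrable'
  by_cases h0 : g c = 0
  · rw [h0, norm_zero, zero_rpow hq.ne']
    refine mul_nonneg (by positivity) ?_
    exact intervalIntegral.integral_nonneg two_pi_pos.le (fun _ _ => by positivity)
  set a := ‖g c‖ with ha
  have hapos : 0 < a := norm_pos_iff.2 h0
  have hg' : AnalyticOnNhd ℂ g (closedBall c |R|) := by rwa [hRabs]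
  have hlog : log a ≤ circleAverage (log ‖g ·‖) c R := by
    rw [hg'.circleAverage_log_norm hR.ne' h0]
    refine le_add_of_nonneg_left (finsum_nonneg fun u => ?_)
    by_cases hu : u ∈ closedBall c |R|
    · refine mul_nonneg ?_ ?_
      · exact_mod_cast (MeromorphicOn.AnalyticOnNhd.divisor_nonneg hg') u
      · by_cases huc : c - u = 0
        · simp [huc]
        · apply log_nonneg
          rw [← div_eq_mul_inv, one_le_div (norm_pos_iff.2 huc)]
          rwa [mem_closedBall, dist_comm, dist_eq_norm, hRabs] at hu
    · rw [Function.locallyFinsuppWithin.apply_eq_zero_of_notMem _ hu]; simp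
  -- Since `log 0 = 0` in Lean, the pointwise bound below could fail at zeros of `g`. The value `log
  -- a - 1 / q` makes a^q (1 + q (h - log a)) vanish there, and changing h on a discrete set leaves
  -- the average alone.
  set h : ℂ → ℝ := fun z => if g z = 0 then log a - 1 / q else log ‖g z‖ with hh
  have hcod : (log ‖g ·‖) =ᶠ[codiscreteWithin (sphere c |R|)] h := by
    have h1 := hg'.preimage_zero_mem_codiscreteWithin (x := c) h0 (by simp)
      ⟨⟨c, by simp⟩, (convex_closedBall c |R|).isPreconnected⟩
    have h2 := codiscreteWithin_mono (sphere_subset_closedBall (x := c) (ε := |R|)) h1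
    filter_upwards [h2] with z hz
    have : g z ≠ 0 := by simpa using hz
    simp [hh, this]
  have hmer : MeromorphicOn g (sphere c |R|) :=
    (hg'.mono sphere_subset_closedBall).meromorphicOn
  have hhint : CircleIntegrable h c R := hmer.circleIntegrable_log_norm.congr_codiscreteWithin hcod
  rw [circleAverage_congr_codiscreteWithin hcod hR.ne'] at hlog
  have hpt : ∀ z ∈ sphere c |R|, ((fun _ => a ^ q - a ^ q * q * log a : ℂ → ℝ) + (a ^ q * q) • h) z
      ≤ ‖g z‖ ^ q := by
    intro z _
    by_cases hz : g z = 0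
    · simp only [hh, Pi.add_apply, Pi.smul_apply, smul_eq_mul, hz, if_true, norm_zero,
        zero_rpow hq.ne']
      apply le_of_eq; field_simp; ring
    · have hgz : 0 < ‖g z‖ := norm_pos_iff.2 hz
      have e1 : ‖g z‖ ^ q = a ^ q * exp (q * (log ‖g z‖ - log a)) := by
        rw [rpow_def_of_pos hgz, rpow_def_of_pos hapos, ← exp_add]; ring_nf
      simp only [hh, Pi.add_apply, Pi.smul_apply, smul_eq_mul, hz, if_false, e1]
      have := mul_le_mul_of_nonneg_left (add_one_le_exp (q * (log ‖g z‖ - log a)))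
        (rpow_nonneg hapos.le q)
      linarith
  have hm := circleAverage_mono ((circleIntegrable_const _ c R).add (hhint.const_smul (a := a ^ q * q)))
    hint hpt
  rw [circleAverage_add (circleIntegrable_const _ c R) hhint.const_smul, circleAverage_const,
    circleAverage_smul, smul_eq_mul] at hm
  have := mul_le_mul_of_nonneg_left hlog (mul_nonneg (rpow_nonneg hapos.le q) hq.le)
  linarith

open Set in
/-- A continuous function that lies below its averages `θ ↦ φ (t + ρ cos θ)` satisfies the maximum
principle on intervals. -/
theorem le_of_le_average_cos {φ : ℝ → ℝ} {a b K : ℝ} (hab : a ≤ b)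
    (hφ : ContinuousOn φ (Icc a b))
    (hsub : ∀ t ρ, 0 < ρ → Icc (t - ρ) (t + ρ) ⊆ Icc a b →
      φ t ≤ (2 * Real.pi)⁻¹ * ∫ θ in (0 : ℝ)..2 * Real.pi, φ (t + ρ * Real.cos θ))
    (ha : φ a ≤ K) (hb : φ b ≤ K) : ∀ t ∈ Icc a b, φ t ≤ K := by
  -- Adding ε t² makes the sub-mean inequality strict: at an interior maximum, cos² averages to 1/2
  -- and leaves a deficit of ε ρ² / 2. Then ε tends to 0.
  have key : ∀ ε > 0, ∀ t ∈ Icc a b, φ t + ε * t ^ 2 ≤ K + ε * (a ^ 2 + b ^ 2) := by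
    intro ε hε
    obtain ⟨t₀, ht₀, hmax⟩ := isCompact_Icc.exists_isMaxOn (nonempty_Icc.2 hab)
      (f := fun t => φ t + ε * t ^ 2) (hφ.add (by fun_prop))
    intro t ht
    refine (hmax ht).trans ?_
    rcases eq_or_lt_of_le ht₀.1 with h | h
    · subst h; simp only; nlinarith [sq_nonneg b, mul_nonneg hε.le (sq_nonneg b)]
    rcases eq_or_lt_of_le ht₀.2 with h' | h'
    · subst h'; simp only; nlinarith [sq_nonneg a, mul_nonneg hε.le (sq_nonneg a)]
    exfalso
    set ρ := min (t₀ - a) (b - t₀) with hρ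
    have hρ0 : 0 < ρ := lt_min (by linarith) (by linarith)
    have hρ1 : ρ ≤ t₀ - a := min_le_left _ _
    have hρ2 : ρ ≤ b - t₀ := min_le_right _ _
    have hs := hsub t₀ ρ hρ0 (Icc_subset_Icc (by linarith) (by linarith))
    have hmem : ∀ θ : ℝ, t₀ + ρ * Real.cos θ ∈ Icc a b := fun θ => by
      constructor
      · nlinarith [Real.neg_one_le_cos θ]
      · nlinarith [Real.cos_le_one θ]
    have hc1 : Continuous fun θ : ℝ => φ (t₀ + ρ * Real.cos θ) :=
      hφ.comp_continuous (by fun_prop) hmem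
    have hle : ∫ θ in (0 : ℝ)..2 * Real.pi, φ (t₀ + ρ * Real.cos θ) ≤
        ∫ θ in (0 : ℝ)..2 * Real.pi,
          (φ t₀ - ε * ρ ^ 2 * Real.cos θ ^ 2 - 2 * ε * t₀ * ρ * Real.cos θ) := by
      apply intervalIntegral.integral_mono_on (by positivity) (hc1.intervalIntegrable _ _)
        (Continuous.intervalIntegrable (by fun_prop) _ _)
      intro θ _
      have := hmax (hmem θ)
      simp only [mem_ofPred_eq] at this
      nlinarith
    rw [intervalIntegral.integral_sub, intervalIntegral.integral_sub,
      intervalIntegral.integral_const_mul, intervalIntegral.integral_const_mul,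
      integral_cos_sq, integral_cos] at hle
    · simp only [intervalIntegral.integral_const, Real.sin_two_pi, Real.sin_zero, smul_eq_mul,
        sub_zero, mul_zero, zero_add] at hle
      have h3 := mul_le_mul_of_nonneg_left hle (inv_nonneg.2 Real.two_pi_pos.le)
      have h4 : (2 * Real.pi)⁻¹ * (2 * Real.pi * φ t₀ - ε * ρ ^ 2 * (2 * Real.pi / 2))
          = φ t₀ - ε * ρ ^ 2 / 2 := by
        field_simp
      have h5 : 0 < ε * ρ ^ 2 := by positivity
      rw [h4] at h3
      linarith
    all_goals exact Continuous.intervalIntegrable (by fun_prop) _ _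
  intro t ht
  have hlim : Filter.Tendsto (fun ε : ℝ => K + ε * (a ^ 2 + b ^ 2) - ε * t ^ 2)
      (nhdsWithin 0 (Ioi 0)) (nhds (K + 0 * (a ^ 2 + b ^ 2) - 0 * t ^ 2)) :=
    (Continuous.tendsto (by fun_prop) 0).mono_left nhdsWithin_le_nhds
  have := ge_of_tendsto hlim (b := φ t) (by
    filter_upwards [self_mem_nhdsWithin] with ε hε
    linarith [key ε hε t ht])
  simpa using this

/-! ### Normalized volume, rotations and dilations. -/

theorem measurableSet_cBall (d : ℕ) (r : ℝ) : MeasurableSet (cBall d r) := measurableSet_ball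

theorem volume_cBall_one_ne_zero (d : ℕ) : (volume : Measure (CSpace d)) (cBall d 1) ≠ 0 :=
  (Metric.measure_ball_pos _ _ one_pos).ne'

theorem volume_cBall_one_ne_top (d : ℕ) : (volume : Measure (CSpace d)) (cBall d 1) ≠ ⊤ :=
  measure_ball_lt_top.ne

instance isProbabilityMeasure_normalizedVolume (d : ℕ) :
    IsProbabilityMeasure (normalizedVolume d) where
  measure_univ := by
    simp only [normalizedVolume, Measure.smul_apply, Measure.restrict_apply_univ, smul_eq_mul]
    exact ENNReal.inv_mul_cancel (volume_cBall_one_ne_zero d) (volume_cBall_one_ne_top d)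

theorem ae_mem_cBall (d : ℕ) : ∀ᵐ z ∂normalizedVolume d, z ∈ cBall d 1 := by
  rw [normalizedVolume]
  exact Measure.ae_smul_measure (ae_restrict_mem (measurableSet_cBall d 1)) _

/-- Rotation invariance of the normalized volume. -/
theorem measurePreserving_rotation (d : ℕ) {ω : ℂ} (hω : ‖ω‖ = 1) :
    MeasurePreserving (fun z : CSpace d => ω • z) (normalizedVolume d) (normalizedVolume d) := by
  have hω0 : ω ≠ 0 := by rintro rfl; simp at hω
  let e : CSpace d ≃ₗᵢ[ℝ] CSpace d :=
    { (LinearEquiv.smulOfNeZero ℂ (CSpace d) ω hω0).restrictScalars ℝ with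
      norm_map' := fun z => by
        change ‖ω • z‖ = ‖z‖
        rw [norm_smul, hω, one_mul] }
  have h1 : MeasurePreserving (fun z : CSpace d => ω • z) volume volume := e.measurePreserving
  have h2 := h1.restrict_preimage (measurableSet_cBall d 1)
  have h3 : (fun z : CSpace d => ω • z) ⁻¹' cBall d 1 = cBall d 1 := by
    ext z; simp [cBall, norm_smul, hω]
  rw [h3] at h2
  refine ⟨h1.measurable, ?_⟩
  rw [normalizedVolume, Measure.map_smul, h2.map_eq]

theorem normalizedVolume_restrict_cBall (d : ℕ) {r : ℝ} (hr : r ≤ 1) :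
    (normalizedVolume d).restrict (cBall d r) =
      ((volume : Measure (CSpace d)) (cBall d 1))⁻¹ • volume.restrict (cBall d r) := by
  rw [normalizedVolume, Measure.restrict_smul, Measure.restrict_restrict (measurableSet_cBall d r),
    Set.inter_eq_left.2 (show cBall d r ⊆ cBall d 1 from Metric.ball_subset_ball hr)]

open Pointwise in
theorem setIntegral_cBall (d : ℕ) {r : ℝ} (hr : 0 < r) (hr1 : r ≤ 1) (F : CSpace d → ℝ) :
    ∫ z in cBall d r, F z ∂normalizedVolume d =
      r ^ Module.finrank ℝ (CSpace d) * ∫ z, F ((r : ℂ) • z) ∂normalizedVolume d := by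
  have h := Measure.setIntegral_comp_smul_of_pos (volume : Measure (CSpace d)) F (cBall d 1) hr
  have hb : r • cBall d 1 = cBall d r := by
    simp only [cBall, smul_unitBall_of_pos hr]
  rw [hb] at h
  rw [normalizedVolume_restrict_cBall d hr1, integral_smul_measure]
  rw [normalizedVolume, integral_smul_measure]
  simp only [Complex.coe_smul, h, smul_eq_mul]
  have : r ^ Module.finrank ℝ (CSpace d) ≠ 0 := by positivity
  field_simp

/-- The Jacobian of the dilation cancels against the volume of `r B_d`, so the dimension disappears
from the mean. -/
theorem volumeMean_eq (d : ℕ) (q : ℝ) (f : CSpace d → ℂ) {r : ℝ} (hr : 0 < r) (hr1 : r ≤ 1) :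
    volumeMean d q f r = (∫ z, ‖f ((r : ℂ) • z)‖ ^ q ∂normalizedVolume d) ^ (1 / q) := by
  have h1 : (normalizedVolume d).real (cBall d r) = r ^ Module.finrank ℝ (CSpace d) := by
    have := setIntegral_cBall d hr hr1 (fun _ => 1)
    simpa using this
  rw [volumeMean, h1, setIntegral_cBall d hr hr1]
  have : r ^ Module.finrank ℝ (CSpace d) ≠ 0 := by positivity
  congr 1
  field_simp

/-- The `q`-th power mean over the unit ball of the dilated function `z ↦ f (c z)`. -/
noncomputable def dilationIntegral (d : ℕ) (q : ℝ) (f : CSpace d → ℂ) (c : ℂ) : ℝ :=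
  ∫ z, ‖f (c • z)‖ ^ q ∂normalizedVolume d

theorem dilationIntegral_nonneg (d : ℕ) (q : ℝ) (f : CSpace d → ℂ) (c : ℂ) :
    0 ≤ dilationIntegral d q f c :=
  integral_nonneg fun _ => by positivity

theorem dilationIntegral_rotation (d : ℕ) (q : ℝ) (f : CSpace d → ℂ) {ω : ℂ} (hω : ‖ω‖ = 1)
    (c : ℂ) : dilationIntegral d q f (c * ω) = dilationIntegral d q f c := by
  have hω0 : ω ≠ 0 := by rintro rfl; simp at hω
  have h := (measurePreserving_rotation d hω).integral_comp
    (Homeomorph.smulOfNeZero ω hω0).measurableEmbedding (fun z => ‖f (c • z)‖ ^ q)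
  simpa only [dilationIntegral, mul_smul] using h

theorem smul_mem_cBall {d : ℕ} {c : ℂ} {z : CSpace d} (hc : ‖c‖ ≤ 1) (hz : z ∈ cBall d 1) :
    c • z ∈ cBall d 1 := by
  simp only [cBall, mem_ball_zero_iff, norm_smul] at hz ⊢
  nlinarith [norm_nonneg z, norm_nonneg c]

theorem IsHolomorphicOnBall.exists_bound {d : ℕ} {f : CSpace d → ℂ} (hf : IsHolomorphicOnBall d f)
    {ρ : ℝ} (hρ : ρ < 1) :
    ∃ K, ∀ c : ℂ, ‖c‖ ≤ ρ → ∀ z ∈ cBall d 1, ‖f (c • z)‖ ≤ K := by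
  obtain ⟨K, hK⟩ := (isCompact_closedBall (0 : CSpace d) ρ).exists_bound_of_continuousOn
    (hf.continuousOn.mono (Metric.closedBall_subset_ball hρ))
  refine ⟨K, fun c hc z hz => hK _ ?_⟩
  simp only [cBall, mem_ball_zero_iff] at hz
  simp only [mem_closedBall_zero_iff, norm_smul]
  nlinarith [norm_nonneg z, norm_nonneg c]

theorem IsHolomorphicOnBall.exists_rpow_bound {d : ℕ} {f : CSpace d → ℂ}
    (hf : IsHolomorphicOnBall d f) {ρ q : ℝ} (hρ : ρ < 1) (hq : 0 < q) :
    ∃ K, ∀ c : ℂ, ‖c‖ ≤ ρ → ∀ z ∈ cBall d 1, ‖f (c • z)‖ ^ q ≤ K := by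
  obtain ⟨K, hK⟩ := hf.exists_bound hρ
  exact ⟨K ^ q, fun c hc z hz => Real.rpow_le_rpow (norm_nonneg _) (hK c hc z hz) hq.le⟩

theorem continuousOn_dilationIntegral {d : ℕ} {q : ℝ} (hq : 0 < q) {f : CSpace d → ℂ}
    (hf : IsHolomorphicOnBall d f) (hm : Measurable f) :
    ContinuousOn (dilationIntegral d q f) (Metric.ball 0 1) := by
  intro c₀ hc₀
  rw [mem_ball_zero_iff] at hc₀
  obtain ⟨ρ, h1, h2⟩ := exists_between hc₀
  obtain ⟨K, hK⟩ := hf.exists_rpow_bound h2 hq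
  apply ContinuousAt.continuousWithinAt
  have hev : ∀ᶠ c : ℂ in nhds c₀, ‖c‖ ≤ ρ :=
    (continuous_norm.continuousAt.eventually (gt_mem_nhds h1)).mono fun _ h => h.le
  refine continuousAt_of_dominated (bound := fun _ => K) ?_ ?_ (integrable_const _) ?_
  · exact Filter.Eventually.of_forall fun c =>
      (((hm.comp (measurable_const_smul c)).norm).pow_const q).aestronglyMeasurable
  · filter_upwards [hev] with c hc
    filter_upwards [ae_mem_cBall d] with z hz
    rw [Real.norm_of_nonneg (by positivity)]
    exact hK c hc z hz
  · filter_upwards [ae_mem_cBall d] with z hz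
    have h3 : ContinuousAt f (c₀ • z) :=
      hf.continuousOn.continuousAt (Metric.isOpen_ball.mem_nhds (smul_mem_cBall hc₀.le hz))
    have h4 : ContinuousAt (fun c : ℂ => f (c • z)) c₀ :=
      ContinuousAt.comp (f := fun c : ℂ => c • z) h3 (by fun_prop)
    exact h4.norm.rpow_const (Or.inr hq.le)

/-! ### Log-convexity of the power means. -/

/-- Rotation invariance leaves only the modulus. Averages over circles in ζ thus become averages
over `t + ρ * cos θ`. -/
theorem dilationIntegral_eq_of_norm_eq (d : ℕ) (q : ℝ) (f : CSpace d → ℂ) (ζ : ℂ) :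
    dilationIntegral d q f (Complex.exp ζ) = dilationIntegral d q f (Real.exp ζ.re) := by
  have h : Complex.exp ζ = (Real.exp ζ.re : ℂ) * Complex.exp (ζ.im * Complex.I) := by
    rw [Complex.ofReal_exp, ← Complex.exp_add, Complex.re_add_im]
  rw [h, dilationIntegral_rotation _ _ _ (Complex.norm_exp_ofReal_mul_I _)]

/-- The slice `ζ ↦ exp (c ζ / q) f (exp ζ • z)`, on the left half-plane. -/
noncomputable def expSlice {d : ℕ} (f : CSpace d → ℂ) (q c : ℝ) (z : CSpace d) (ζ : ℂ) : ℂ :=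
  Complex.exp ((c / q : ℝ) * ζ) * f (Complex.exp ζ • z)

theorem norm_expSlice_rpow {d : ℕ} {q : ℝ} (hq : 0 < q) (f : CSpace d → ℂ) (c : ℝ) (z : CSpace d)
    (ζ : ℂ) : ‖expSlice f q c z ζ‖ ^ q = Real.exp (c * ζ.re) * ‖f (Complex.exp ζ • z)‖ ^ q := by
  rw [expSlice, norm_mul, Real.mul_rpow (norm_nonneg _) (norm_nonneg _), Complex.norm_exp,
    Complex.re_ofReal_mul, ← Real.exp_mul]
  congr 2
  field_simp

theorem integral_norm_expSlice_rpow {d : ℕ} {q : ℝ} (hq : 0 < q) (f : CSpace d → ℂ) (c : ℝ)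
    (ζ : ℂ) : ∫ z, ‖expSlice f q c z ζ‖ ^ q ∂normalizedVolume d =
      Real.exp (c * ζ.re) * dilationIntegral d q f (Real.exp ζ.re) := by
  simp only [norm_expSlice_rpow hq]
  rw [integral_const_mul, ← dilationIntegral_eq_of_norm_eq, dilationIntegral]

theorem differentiableOn_expSlice {d : ℕ} {f : CSpace d → ℂ}
    (hf : IsHolomorphicOnBall d f) (q c : ℝ) {z : CSpace d} (hz : z ∈ cBall d 1) :
    DifferentiableOn ℂ (expSlice f q c z) {ζ | ζ.re < 0} := by
  unfold expSlice
  refine DifferentiableOn.mul (by fun_prop) ?_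
  refine DifferentiableOn.comp (t := cBall d 1) hf (by fun_prop) ?_
  intro ζ hζ
  refine smul_mem_cBall ?_ hz
  rw [Complex.norm_exp]
  exact (Real.exp_lt_one_iff.2 hζ).le

theorem measurable_norm_expSlice_rpow {d : ℕ} {f : CSpace d → ℂ} (hm : Measurable f) (q c : ℝ) :
    Measurable (Function.uncurry fun (z : CSpace d) (ζ : ℂ) => ‖expSlice f q c z ζ‖ ^ q) := by
  simp only [Function.uncurry_def, expSlice]
  refine ((Measurable.mul (Continuous.measurable (by fun_prop))
      (hm.comp (Continuous.measurable ?_))).norm).pow_const q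
  fun_prop

theorem exists_norm_expSlice_rpow_bound {d : ℕ} {q : ℝ} (hq : 0 < q) {f : CSpace d → ℂ}
    (hf : IsHolomorphicOnBall d f) (c : ℝ) {s t : ℝ} (ht : t < 0) :
    ∃ K, ∀ ζ : ℂ, ζ.re ∈ Set.Icc s t → ∀ z ∈ cBall d 1, ‖expSlice f q c z ζ‖ ^ q ≤ K := by
  obtain ⟨K, hK⟩ := hf.exists_rpow_bound (Real.exp_lt_one_iff.2 ht) hq
  refine ⟨Real.exp (|c| * max |s| |t|) * K, fun ζ hζ z hz => ?_⟩
  rw [norm_expSlice_rpow hq]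
  refine mul_le_mul ?_ (hK _ ?_ z hz) (by positivity) (Real.exp_nonneg _)
  · apply Real.exp_le_exp.2
    refine (le_abs_self _).trans ?_
    rw [abs_mul]
    gcongr
    exact abs_le_max_abs_abs hζ.1 hζ.2
  · rw [Complex.norm_exp]
    exact Real.exp_le_exp.2 hζ.2

theorem norm_expSlice_rpow_le_average {d : ℕ} {q : ℝ} (hq : 0 < q) {f : CSpace d → ℂ}
    (hf : IsHolomorphicOnBall d f) (c t : ℝ) {ρ : ℝ} (hρ : 0 < ρ) (htρ : t + ρ < 0)
    {z : CSpace d} (hz : z ∈ cBall d 1) :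
    ‖expSlice f q c z t‖ ^ q ≤ (2 * Real.pi)⁻¹ *
      ∫ θ in Set.Ioc 0 (2 * Real.pi), ‖expSlice f q c z (circleMap t ρ θ)‖ ^ q := by
  have han : AnalyticOnNhd ℂ (expSlice f q c z) (Metric.closedBall (t : ℂ) ρ) := by
    refine ((differentiableOn_expSlice hf q c hz).analyticOnNhd
      (isOpen_lt Complex.continuous_re continuous_const)).mono ?_
    intro ζ hζ
    have h1 := (Complex.abs_re_le_norm (ζ - t)).trans (mem_closedBall_iff_norm.1 hζ)
    have h2 := (abs_le.1 h1).2
    simp only [Complex.sub_re, Complex.ofReal_re] at h2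
    change ζ.re < 0
    linarith
  have := norm_rpow_le_circleAverage hρ hq han
  rwa [Real.circleAverage, intervalIntegral.integral_of_le Real.two_pi_pos.le, smul_eq_mul] at this

/-- Each slice satisfies the sub-mean inequality on the circle about `t`; integrating over the ball
and exchanging integrals by Fubini gives the claim. Joint measurability is where `hm` enters. -/
theorem dilationIntegral_le_average {d : ℕ} {q : ℝ} (hq : 0 < q) {f : CSpace d → ℂ}
    (hf : IsHolomorphicOnBall d f) (hm : Measurable f) (c t : ℝ) {ρ : ℝ} (hρ : 0 < ρ)
    (htρ : t + ρ < 0) :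
    Real.exp (c * t) * dilationIntegral d q f (Real.exp t) ≤
      (2 * Real.pi)⁻¹ * ∫ θ in (0 : ℝ)..2 * Real.pi,
        Real.exp (c * (t + ρ * Real.cos θ)) *
          dilationIntegral d q f (Real.exp (t + ρ * Real.cos θ) : ℝ) := by
  have hre : ∀ θ, (circleMap t ρ θ).re = t + ρ * Real.cos θ := fun θ => by simp [circleMap]
  obtain ⟨K, hK⟩ := exists_norm_expSlice_rpow_bound (s := t - ρ) hq hf c htρ
  have hmem : ∀ θ, (circleMap t ρ θ).re ∈ Set.Icc (t - ρ) (t + ρ) := fun θ => by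
    rw [hre]
    constructor
    · nlinarith [Real.neg_one_le_cos θ]
    · nlinarith [Real.cos_le_one θ]
  have hcircle : Continuous (circleMap t ρ) := continuous_circleMap _ _
  have hmeas := measurable_norm_expSlice_rpow hm q c
  have hmeas1 : Measurable (Function.uncurry fun (z : CSpace d) (θ : ℝ) =>
      ‖expSlice f q c z (circleMap t ρ θ)‖ ^ q) :=
    hmeas.comp (g := Function.uncurry fun (z : CSpace d) (ζ : ℂ) => ‖expSlice f q c z ζ‖ ^ q)
      (f := fun p : CSpace d × ℝ => (p.1, circleMap t ρ p.2)) (by fun_prop)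
  have hprod : Integrable (Function.uncurry fun (z : CSpace d) (θ : ℝ) =>
      ‖expSlice f q c z (circleMap t ρ θ)‖ ^ q)
      ((normalizedVolume d).prod (volume.restrict (Set.Ioc 0 (2 * Real.pi)))) := by
    refine Integrable.of_bound hmeas1.aestronglyMeasurable K ?_
    filter_upwards [Measure.quasiMeasurePreserving_fst.ae (ae_mem_cBall d)] with p hp
    rw [Function.uncurry_def, Real.norm_of_nonneg (by positivity)]
    exact hK _ (hmem _) _ hp
  have hRHS : ∀ θ, Real.exp (c * (t + ρ * Real.cos θ)) *
      dilationIntegral d q f (Real.exp (t + ρ * Real.cos θ) : ℝ) =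
      ∫ z, ‖expSlice f q c z (circleMap t ρ θ)‖ ^ q ∂normalizedVolume d := fun θ => by
    rw [integral_norm_expSlice_rpow hq, hre]
  have hLHS := integral_norm_expSlice_rpow hq f c t
  rw [Complex.ofReal_re] at hLHS
  simp only [hRHS]
  rw [← hLHS, intervalIntegral.integral_of_le Real.two_pi_pos.le,
    ← integral_integral_swap hprod, ← integral_const_mul]
  refine integral_mono_ae ?_ (hprod.integral_prod_left.const_mul _) ?_
  · refine Integrable.of_bound
      (hmeas.comp (measurable_id.prodMk measurable_const)).aestronglyMeasurable K ?_
    filter_upwards [ae_mem_cBall d] with z hz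
    rw [Real.norm_of_nonneg (by positivity)]
    refine hK _ ?_ _ hz
    rw [Complex.ofReal_re]
    constructor <;> linarith
  · filter_upwards [ae_mem_cBall d] with z hz
    exact norm_expSlice_rpow_le_average hq hf c t hρ htρ hz

theorem continuousOn_dilationIntegral_ofReal {d : ℕ} {q : ℝ} (hq : 0 < q) {f : CSpace d → ℂ}
    (hf : IsHolomorphicOnBall d f) (hm : Measurable f) :
    ContinuousOn (fun r : ℝ => dilationIntegral d q f r) (Set.Ico 0 1) := by
  refine (continuousOn_dilationIntegral hq hf hm).comp
    Complex.continuous_ofReal.continuousOn ?_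
  intro r hr
  rw [mem_ball_zero_iff, Complex.norm_real, Real.norm_of_nonneg hr.1]
  exact hr.2

/-- An analogue of Hadamard's three circles theorem: a positive function whose products with all
e^{ct} obey the maximum principle has a convex logarithm. -/
theorem convexOn_log_dilationIntegral {d : ℕ} {q : ℝ} (hq : 0 < q) {f : CSpace d → ℂ}
    (hf : IsHolomorphicOnBall d f) (hm : Measurable f)
    (hpos : ∀ r : ℝ, 0 < r → r < 1 → 0 < dilationIntegral d q f r) :
    ConvexOn ℝ (Set.Iio 0) fun t => Real.log (dilationIntegral d q f (Real.exp t : ℝ)) := by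
  have hpos' : ∀ t < 0, 0 < dilationIntegral d q f (Real.exp t : ℝ) := fun t ht =>
    hpos _ (Real.exp_pos t) (Real.exp_lt_one_iff.2 ht)
  refine LinearOrder.convexOn_of_lt (convex_Iio 0) ?_
  intro x hx y hy hxy a b ha hb hab
  simp only [Set.mem_Iio, smul_eq_mul] at hx hy ⊢
  set N : ℝ → ℝ := fun t => dilationIntegral d q f (Real.exp t : ℝ) with hN
  change Real.log (N (a * x + b * y)) ≤ a * Real.log (N x) + b * Real.log (N y)
  -- This slope gives e^{ct} N(t) the same value e^κ at `x` and `y`, so the maximum principle on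
  -- `[x, y]` is exactly the convexity inequality.
  set c := (Real.log (N x) - Real.log (N y)) / (y - x) with hc
  have hcxy : c * x + Real.log (N x) = c * y + Real.log (N y) := by
    have : y - x ≠ 0 := by linarith
    rw [hc]; field_simp; ring
  set κ := c * x + Real.log (N x) with hκ
  have hmem : a * x + b * y ∈ Set.Icc x y := by
    have hb' : b = 1 - a := by linarith
    subst hb'
    constructor <;> nlinarith
  have hcont : ContinuousOn (fun t => Real.exp (c * t) * N t) (Set.Icc x y) := by
    refine ContinuousOn.mul (by fun_prop) ?_
    refine (continuousOn_dilationIntegral_ofReal hq hf hm).comp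
      Real.continuous_exp.continuousOn ?_
    intro t ht
    exact ⟨(Real.exp_pos t).le, Real.exp_lt_one_iff.2 (ht.2.trans_lt hy)⟩
  have hmax := le_of_le_average_cos (K := Real.exp κ) hxy.le hcont (fun t ρ hρ hsub => ?_) ?_ ?_
    _ hmem
  · have hlt : a * x + b * y < 0 := hmem.2.trans_lt hy
    have h1 := Real.log_le_log (mul_pos (Real.exp_pos _) (hpos' _ hlt)) hmax
    rw [Real.log_exp, Real.log_mul (Real.exp_pos _).ne' (hpos' _ hlt).ne', Real.log_exp] at h1
    have h2 : κ = a * κ + b * κ := by rw [← add_mul, hab, one_mul]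
    have h3 : b * κ = b * (c * y + Real.log (N y)) := by rw [hcxy]
    have h4 : a * κ = a * (c * x + Real.log (N x)) := rfl
    change c * (a * x + b * y) + Real.log (N (a * x + b * y)) ≤ κ at h1
    linarith
  · refine dilationIntegral_le_average hq hf hm c t hρ ?_
    exact (hsub (Set.right_mem_Icc.2 (by linarith))).2.trans_lt hy
  · rw [hκ, Real.exp_add, Real.exp_log (hpos' x hx)]
  · rw [hcxy, Real.exp_add, Real.exp_log (hpos' y hy)]

/-! ### From a volume mean to a log-convex weight. -/

theorem ConvexOn.monotoneOn_Iio_of_bddAbove {Φ : ℝ → ℝ} (hΦ : ConvexOn ℝ (Set.Iio 0) Φ) {T K : ℝ}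
    (hK : ∀ t ≤ T, Φ t ≤ K) : MonotoneOn Φ (Set.Iio 0) := by
  intro x hx y hy hxy
  rcases hxy.eq_or_lt with rfl | hlt
  · rfl
  by_contra! h
  set σ := (Φ x - Φ y) / (y - x) with hσ
  have hyx : 0 < y - x := by linarith
  have hσ0 : 0 < σ := div_pos (by linarith) hyx
  -- Far enough to the left that a slope of at most -σ forces `Φ s ≥ K + 1`.
  set s := min T (min (x - 1) (x - (K - Φ x + 1) / σ)) with hs
  have hs1 : s ≤ T := min_le_left _ _
  have hs2 : s ≤ x - 1 := (min_le_right _ _).trans (min_le_left _ _)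
  have hs3 : s ≤ x - (K - Φ x + 1) / σ := (min_le_right _ _).trans (min_le_right _ _)
  simp only [Set.mem_Iio] at hx hy
  have hslope := hΦ.slope_mono_adjacent (show s ∈ Set.Iio 0 from by simp only [Set.mem_Iio]; linarith)
    (show y ∈ Set.Iio 0 from hy) (show s < x by linarith) hlt
  have hxs : 0 < x - s := by linarith
  have h1 : (Φ y - Φ x) / (y - x) = -σ := by rw [hσ]; ring
  rw [h1, div_le_iff₀ hxs] at hslope
  have h2 : (K - Φ x + 1) / σ ≤ x - s := by linarith
  rw [div_le_iff₀ hσ0] at h2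
  nlinarith [hK s hs1]

theorem le_on_Ico_of_le_on_Ioo {u v : ℝ → ℝ} {b : ℝ} (hb : 0 < b) (hu : ContinuousOn u (Set.Ico 0 b))
    (hv : ContinuousOn v (Set.Ico 0 b)) (h : ∀ r ∈ Set.Ioo 0 b, u r ≤ v r) :
    ∀ r ∈ Set.Ico 0 b, u r ≤ v r := by
  intro r hr
  rcases hr.1.eq_or_lt with rfl | h0
  · have hsub : nhdsWithin (0 : ℝ) (Set.Ioo 0 b) ≤ nhdsWithin 0 (Set.Ico 0 b) :=
      nhdsWithin_mono _ Set.Ioo_subset_Ico_self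
    have : (nhdsWithin (0 : ℝ) (Set.Ioo 0 b)).NeBot := left_nhdsWithin_Ioo_neBot hb
    exact le_of_tendsto_of_tendsto ((hu 0 hr).tendsto.mono_left hsub)
      ((hv 0 hr).tendsto.mono_left hsub) (by filter_upwards [self_mem_nhdsWithin] with x hx using h x hx)
  · exact h r ⟨h0, hr.2⟩

open Classical in
-- Values of `f` off the ball are arbitrary, so `f` need not be measurable; cutting it off by 0
-- changes no mean.
theorem exists_measurable_holomorphic {d : ℕ} {f : CSpace d → ℂ} (hf : IsHolomorphicOnBall d f) :
    ∃ g : CSpace d → ℂ, IsHolomorphicOnBall d g ∧ Measurable g ∧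
      ∀ q : ℝ, ∀ c : ℂ, ‖c‖ ≤ 1 → dilationIntegral d q f c = dilationIntegral d q g c := by
  refine ⟨(cBall d 1).piecewise f 0, ?_, ?_, ?_⟩
  · exact hf.congr fun z hz => Set.piecewise_eq_of_mem _ _ _ hz
  · exact hf.continuousOn.measurable_piecewise continuous_zero.continuousOn
      (measurableSet_cBall d 1)
  · intro q c hc
    refine integral_congr_ae ?_
    filter_upwards [ae_mem_cBall d] with z hz
    rw [Set.piecewise_eq_of_mem _ _ _ (smul_mem_cBall hc hz)]

/-- A weight equivalent to a volume mean of a holomorphic function is equivalent to a log-convex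
weight. -/
theorem exists_logConvex_of_volumeMean {d : ℕ} {q : ℝ} (hq : 0 < q) {w : ℝ → ℝ} (hw : IsWeight w)
    {f : CSpace d → ℂ} (hf : IsHolomorphicOnBall d f)
    (h : EquivalentOn (Set.Ioo 0 1) (volumeMean d q f) w) :
    ∃ v : ℝ → ℝ, IsLogConvexWeight v ∧ EquivalentOn (Set.Ico 0 1) w v := by
  obtain ⟨g, hg, hm, hfg⟩ := exists_measurable_holomorphic hf
  obtain ⟨C₁, C₂, hC₁, hC₂, hC⟩ := h
  set N : ℝ → ℝ := fun r => dilationIntegral d q g r with hN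
  have hN0 : ∀ r, 0 ≤ N r := fun r => dilationIntegral_nonneg _ _ _ _
  have hNc : ContinuousOn N (Set.Ico 0 1) := continuousOn_dilationIntegral_ofReal hq hg hm
  -- Unlike `volumeMean`, which degenerates to 0 at `r = 0`, this expression is continuous there.
  set v : ℝ → ℝ := fun r => N r ^ (1 / q) with hv
  have hvc : ContinuousOn v (Set.Ico 0 1) := hNc.rpow_const fun _ _ => Or.inr (by positivity)
  have hvm : ∀ r ∈ Set.Ioo (0 : ℝ) 1, volumeMean d q f r = v r := by
    intro r hr
    rw [volumeMean_eq d q f hr.1 hr.2.le]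
    change dilationIntegral d q f r ^ (1 / q) = _
    rw [hfg q r (by rw [Complex.norm_real, Real.norm_of_nonneg hr.1.le]; exact hr.2.le)]
  have hle1 : ∀ r ∈ Set.Ico (0 : ℝ) 1, C₁ * v r ≤ w r :=
    le_on_Ico_of_le_on_Ioo one_pos (hvc.const_mul C₁) hw.continuousOn fun r hr =>
      hvm r hr ▸ (hC r hr).1
  have hle2 : ∀ r ∈ Set.Ico (0 : ℝ) 1, w r ≤ C₂ * v r :=
    le_on_Ico_of_le_on_Ioo one_pos hw.continuousOn (hvc.const_mul C₂) fun r hr =>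
      hvm r hr ▸ (hC r hr).2
  have hvpos : ∀ r ∈ Set.Ico (0 : ℝ) 1, 0 < v r := fun r hr =>
    pos_of_mul_pos_right ((hw.pos r hr).trans_le (hle2 r hr)) hC₂.le
  have hNpos : ∀ r ∈ Set.Ico (0 : ℝ) 1, 0 < N r := fun r hr => by
    refine lt_of_le_of_ne (hN0 r) fun h0 => ?_
    have := hvpos r hr
    rw [hv] at this
    simp only [← h0] at this
    rw [Real.zero_rpow (by positivity)] at this
    exact lt_irrefl _ this
  have hconv := convexOn_log_dilationIntegral hq hg hm fun r h0 h1 => hNpos r ⟨h0.le, h1⟩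
  have hmono : MonotoneOn N (Set.Ico 0 1) := by
    obtain ⟨K, hK⟩ := hg.exists_rpow_bound (ρ := Real.exp (-1)) (by simp) hq
    have hKN : ∀ t ≤ (-1 : ℝ), N (Real.exp t) ≤ K := by
      intro t ht
      have : N (Real.exp t) ≤ ∫ _, K ∂normalizedVolume d := by
        refine integral_mono_of_nonneg (Filter.Eventually.of_forall fun _ => by positivity)
          (integrable_const _) ?_
        filter_upwards [ae_mem_cBall d] with z hz
        refine hK _ ?_ z hz
        rw [Complex.norm_real, Real.norm_of_nonneg (Real.exp_pos _).le]
        exact Real.exp_le_exp.2 ht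
      simpa using this
    have hm1 := hconv.monotoneOn_Iio_of_bddAbove (T := -1) (K := Real.log K) fun t ht =>
      Real.log_le_log (hNpos _ ⟨(Real.exp_pos t).le, Real.exp_lt_one_iff.2 (by linarith)⟩)
        (hKN t ht)
    have hm2 : ∀ s ∈ Set.Ioo (0 : ℝ) 1, ∀ r ∈ Set.Ioo (0 : ℝ) 1, s ≤ r → N s ≤ N r := by
      intro s hs r hr hsr
      have := hm1 (Real.log_neg hs.1 hs.2) (Real.log_neg hr.1 hr.2) (Real.log_le_log hs.1 hsr)
      simp only [Real.exp_log hs.1, Real.exp_log hr.1] at this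
      exact (Real.log_le_log_iff (hNpos s ⟨hs.1.le, hs.2⟩) (hNpos r ⟨hr.1.le, hr.2⟩)).1 this
    intro s hs r hr hsr
    rcases hsr.eq_or_lt with rfl | hlt
    · rfl
    have hr0 : 0 < r := hs.1.trans_lt hlt
    refine le_on_Ico_of_le_on_Ioo (u := N) (v := fun _ => N r) hr0
      (hNc.mono (Set.Ico_subset_Ico_right hr.2.le)) continuousOn_const ?_ s ⟨hs.1, hlt⟩
    intro s' hs'
    exact hm2 s' ⟨hs'.1, hs'.2.trans hr.2⟩ r ⟨hr0, hr.2⟩ hs'.2.le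
  refine ⟨v, ⟨⟨hvpos, hvc, ?_⟩, ?_⟩, C₂⁻¹, C₁⁻¹, by positivity, by positivity, fun r hr => ⟨?_, ?_⟩⟩
  · intro s hs r hr hsr
    exact Real.rpow_le_rpow (hN0 s) (hmono hs hr hsr) (by positivity)
  · refine (hconv.smul (show 0 ≤ 1 / q by positivity)).congr fun t ht => ?_
    rw [hv]
    simp only [smul_eq_mul]
    rw [Real.log_rpow (hNpos _ ⟨(Real.exp_pos t).le, Real.exp_lt_one_iff.2 ht⟩)]
  · rw [inv_mul_le_iff₀ hC₂]; exact hle2 r hr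
  · rw [le_inv_mul_iff₀ hC₁]; exact hle1 r hr

/-! ### Supporting lines and the greedy choice of slopes. -/

/-- `Φ` is convex, nondecreasing and continuous on `[-1, 0)`, with supremum `∞`; `τ n` is a point
where the supporting line of slope `n` touches the graph of `Φ`. -/
structure IsTangentSystem (Φ : ℝ → ℝ) (τ : ℕ → ℝ) : Prop where
  convexOn : ConvexOn ℝ (Set.Ico (-1) 0) Φ
  monotoneOn : MonotoneOn Φ (Set.Ico (-1) 0)
  unbounded : ∀ K, ∃ t ∈ Set.Ico (-1 : ℝ) 0, K < Φ t
  mem : ∀ n, τ n ∈ Set.Ico (-1 : ℝ) 0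
  isMin : ∀ n : ℕ, ∀ t ∈ Set.Ico (-1 : ℝ) 0, Φ (τ n) - n * τ n ≤ Φ t - n * t

/-- The supporting line of slope `n`. -/
noncomputable def supportLine (Φ : ℝ → ℝ) (τ : ℕ → ℝ) (n : ℕ) (t : ℝ) : ℝ :=
  n * t + (Φ (τ n) - n * τ n)

/-- The supporting lines of slopes `m` and `n` differ by at least `a` at both contact points. -/
def Separated (Φ : ℝ → ℝ) (τ : ℕ → ℝ) (a : ℝ) (m n : ℕ) : Prop :=
  supportLine Φ τ n (τ m) ≤ Φ (τ m) - a ∧ supportLine Φ τ m (τ n) ≤ Φ (τ n) - a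

theorem exists_isTangentSystem {Φ : ℝ → ℝ} (hc : ContinuousOn Φ (Set.Ico (-1) 0))
    (hconv : ConvexOn ℝ (Set.Ico (-1) 0) Φ) (hmono : MonotoneOn Φ (Set.Ico (-1) 0))
    (hunb : ∀ K, ∃ t ∈ Set.Ico (-1 : ℝ) 0, K < Φ t) : ∃ τ, IsTangentSystem Φ τ := by
  have key : ∀ n : ℕ, ∃ s ∈ Set.Ico (-1 : ℝ) 0, ∀ t ∈ Set.Ico (-1 : ℝ) 0,
      Φ s - n * s ≤ Φ t - n * t := by
    intro n
    -- Beyond this `T`, `Φ t - n * t` exceeds its value at -1, so the minimum may be sought on a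
    -- compact interval.
    obtain ⟨T, hT, hTK⟩ := hunb (Φ (-1) + n)
    have hsub : Set.Icc (-1) T ⊆ Set.Ico (-1) 0 := fun x hx => ⟨hx.1, hx.2.trans_lt hT.2⟩
    obtain ⟨s, hs, hmin⟩ := isCompact_Icc.exists_isMinOn (Set.nonempty_Icc.2 hT.1)
      (f := fun t => Φ t - n * t) ((hc.mono hsub).sub (by fun_prop))
    refine ⟨s, hsub hs, fun t ht => ?_⟩
    rcases le_total t T with h | h
    · exact hmin ⟨ht.1, h⟩
    · have h1 := hmin (Set.left_mem_Icc.2 hT.1)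
      simp only [Set.mem_ofPred_eq] at h1
      have h2 := hmono hT ht h
      have h3 : (0 : ℝ) ≤ n * (-t) := mul_nonneg n.cast_nonneg (by linarith [ht.2])
      linarith
  choose τ h1 h2 using key
  exact ⟨τ, hconv, hmono, hunb, h1, h2⟩

namespace IsTangentSystem

variable {Φ : ℝ → ℝ} {τ : ℕ → ℝ}

theorem neg_one_mem : (-1 : ℝ) ∈ Set.Ico (-1 : ℝ) 0 := by constructor <;> norm_num

theorem supportLine_le (h : IsTangentSystem Φ τ) (n : ℕ) {t : ℝ} (ht : t ∈ Set.Ico (-1 : ℝ) 0) :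
    supportLine Φ τ n t ≤ Φ t := by
  have := h.isMin n t ht
  rw [supportLine]; linarith

theorem supportLine_self (Φ : ℝ → ℝ) (τ : ℕ → ℝ) (n : ℕ) : supportLine Φ τ n (τ n) = Φ (τ n) := by
  rw [supportLine]; ring

theorem supportLine_mono (Φ : ℝ → ℝ) (τ : ℕ → ℝ) (n : ℕ) : Monotone (supportLine Φ τ n) := by
  intro s t hst
  simp only [supportLine]
  gcongr

theorem supportLine_sub_mono (Φ : ℝ → ℝ) (τ : ℕ → ℝ) {m n : ℕ} (hmn : m ≤ n) {s t : ℝ}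
    (hst : s ≤ t) : supportLine Φ τ n s - supportLine Φ τ m s ≤
      supportLine Φ τ n t - supportLine Φ τ m t := by
  have h : (m : ℝ) ≤ n := Nat.cast_le.2 hmn
  simp only [supportLine]
  nlinarith

/-- Passing to the next slope never lowers the intercept, and `t ≥ -1` costs at most 1. This is why
integer slopes are enough. -/
theorem supportLine_le_succ (h : IsTangentSystem Φ τ) (n : ℕ) {t : ℝ} (ht : -1 ≤ t) :
    supportLine Φ τ n t - 1 ≤ supportLine Φ τ (n + 1) t := by
  have h1 := h.isMin n _ (h.mem (n + 1))
  have h2 := (h.mem (n + 1)).2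
  simp only [supportLine]
  push_cast
  linarith

theorem supportLine_zero (h : IsTangentSystem Φ τ) (t : ℝ) : supportLine Φ τ 0 t = Φ (-1) := by
  have h1 := h.isMin 0 _ neg_one_mem
  have h2 := h.monotoneOn neg_one_mem (h.mem 0) (h.mem 0).1
  simp only [supportLine]
  push_cast at *
  linarith

theorem contact_mono (h : IsTangentSystem Φ τ) : Monotone τ := by
  intro m n hmn
  rcases hmn.eq_or_lt with rfl | hlt
  · rfl
  have h1 := h.isMin m _ (h.mem n)
  have h2 := h.isMin n _ (h.mem m)
  have h3 : (0 : ℝ) < n - m := sub_pos.2 (Nat.cast_lt.2 hlt)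
  by_contra! hc
  nlinarith

/-- A contact point left of `T` would make Φ rise by at least n |T| / 2 up to a fixed later point,
impossible for large n. -/
theorem eventually_le_contact (h : IsTangentSystem Φ τ) {T : ℝ} (hT : T < 0) :
    ∀ᶠ n in Filter.atTop, T ≤ τ n := by
  set s := max (T / 2) (-1) with hs
  have hsm : s ∈ Set.Ico (-1 : ℝ) 0 := ⟨le_max_right _ _, max_lt (by linarith) (by norm_num)⟩
  have hsT : T / 2 ≤ s := le_max_left _ _
  have hlim := (tendsto_natCast_atTop_atTop (R := ℝ)).eventually_gt_atTop
    ((Φ s - Φ (-1)) / (-T / 2))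
  filter_upwards [hlim] with n hn
  by_contra! hlt
  rw [div_lt_iff₀ (by linarith)] at hn
  have h1 := h.isMin n s hsm
  have h2 := h.monotoneOn neg_one_mem (h.mem n) (h.mem n).1
  have h3 : (n : ℝ) * (-T / 2) ≤ n * (s - τ n) := by
    apply mul_le_mul_of_nonneg_left _ n.cast_nonneg
    linarith
  linarith

/-- A steep line lying below Φ halfway between `τ m` and 0 is far below Φ at `τ m`. Conversely, line
`m` stays bounded while Φ is unbounded near 0. -/
theorem exists_separated (h : IsTangentSystem Φ τ) (a : ℝ) (m : ℕ) :
    ∃ n, m < n ∧ Separated Φ τ a m n := by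
  obtain ⟨T, hT, hTK⟩ := h.unbounded (supportLine Φ τ m 0 + a)
  set s := τ m / 2 with hs
  have hm := h.mem m
  have hsm : s ∈ Set.Ico (-1 : ℝ) 0 := ⟨by linarith [hm.1], by linarith [hm.2]⟩
  have hlim := (tendsto_natCast_atTop_atTop (R := ℝ)).eventually_gt_atTop
    ((Φ s - Φ (τ m) + a) / (s - τ m))
  obtain ⟨n, h1, h2, h3⟩ := ((h.eventually_le_contact hT.2).and
    (hlim.and (Filter.eventually_gt_atTop m))).exists
  refine ⟨n, h3, ?_, ?_⟩
  · rw [div_lt_iff₀ (by linarith [hm.2])] at h2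
    have h4 := h.supportLine_le n hsm
    simp only [supportLine] at h4 ⊢
    linarith
  · have h4 := h.monotoneOn hT (h.mem n) h1
    have h5 := supportLine_mono Φ τ m (h.mem n).2.le
    linarith

/-- A supporting line that is within `C` of `Φ` at two points is within `C` of `Φ` in between. -/
theorem le_supportLine_add (h : IsTangentSystem Φ τ) (n : ℕ) {C s t : ℝ}
    (hs : s ∈ Set.Ico (-1 : ℝ) 0) (ht : t ∈ Set.Ico (-1 : ℝ) 0)
    (h1 : Φ s ≤ supportLine Φ τ n s + C) (h2 : Φ t ≤ supportLine Φ τ n t + C) {x : ℝ}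
    (hx : x ∈ Set.Icc s t) : Φ x ≤ supportLine Φ τ n x + C := by
  rw [← segment_eq_Icc (hx.1.trans hx.2)] at hx
  obtain ⟨a, b, ha, hb, hab, rfl⟩ := hx
  refine (h.convexOn.2 hs ht ha hb hab).trans ?_
  simp only [smul_eq_mul, supportLine] at *
  have hb' : b = 1 - a := by linarith
  subst hb'
  nlinarith [mul_le_mul_of_nonneg_left h1 ha, mul_le_mul_of_nonneg_left h2 hb]

/-- The slope p = n - 1 failed the separation test. Either line p is within `a` of Φ at `τ m`, so
line n is within `a + 1` there and hence up to `τ n`; or line m is good up to `τ p` and line n from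
there on. -/
theorem le_max_supportLine (h : IsTangentSystem Φ τ) {a : ℝ} (ha : 0 ≤ a) {m n : ℕ} (hmn : m < n)
    (hmin : ∀ k, m < k → k < n → ¬ Separated Φ τ a m k) {x : ℝ} (hx : x ∈ Set.Icc (τ m) (τ n)) :
    Φ x ≤ max (supportLine Φ τ m x) (supportLine Φ τ n x) + (a + 1) := by
  obtain ⟨p, rfl⟩ : ∃ p, n = p + 1 := ⟨n - 1, by omega⟩
  have hm := h.mem m
  have hp := h.mem p
  have hn := h.mem (p + 1)
  have hnn : Φ (τ (p + 1)) ≤ supportLine Φ τ (p + 1) (τ (p + 1)) + (a + 1) := by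
    rw [supportLine_self]; linarith
  have hpn : Φ (τ p) ≤ supportLine Φ τ (p + 1) (τ p) + (a + 1) := by
    have := h.supportLine_le_succ p hp.1
    rw [supportLine_self] at this
    linarith
  have hright : ∀ {s}, s ∈ Set.Ico (-1 : ℝ) 0 →
      Φ s ≤ supportLine Φ τ (p + 1) s + (a + 1) → s ≤ x →
      Φ x ≤ max (supportLine Φ τ m x) (supportLine Φ τ (p + 1) x) + (a + 1) := by
    intro s hs h1 hsx
    have := h.le_supportLine_add (p + 1) hs hn h1 hnn ⟨hsx, hx.2⟩
    exact this.trans (by gcongr; exact le_max_right _ _)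
  rcases (Nat.lt_succ_iff.1 hmn).eq_or_lt with rfl | hlt
  · exact hright hp hpn hx.1
  have hns := hmin p hlt (Nat.lt_succ_self p)
  rw [Separated, not_and_or, not_le, not_le] at hns
  rcases hns with h1 | h1
  · refine hright hm ?_ hx.1
    have := h.supportLine_le_succ p hm.1
    linarith
  · rcases le_total (τ p) x with hpx | hpx
    · exact hright hp hpn hpx
    · have := h.le_supportLine_add m (C := a + 1) hm hp
        (by rw [supportLine_self]; linarith) (by linarith) ⟨hx.1, hpx⟩
      exact this.trans (by gcongr; exact le_max_left _ _)

open Classical in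
/-- A sequence of slopes whose consecutive supporting lines are separated, chosen greedily. -/
noncomputable def slopes (h : IsTangentSystem Φ τ) (a : ℝ) : ℕ → ℕ
  | 0 => 0
  | k + 1 => Nat.find (h.exists_separated a (slopes h a k))

theorem slopes_lt_succ (h : IsTangentSystem Φ τ) (a : ℝ) (k : ℕ) :
    h.slopes a k < h.slopes a (k + 1) := by
  classical
  exact (Nat.find_spec (h.exists_separated a (h.slopes a k))).1

theorem separated_slopes (h : IsTangentSystem Φ τ) (a : ℝ) (k : ℕ) :
    Separated Φ τ a (h.slopes a k) (h.slopes a (k + 1)) := by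
  classical
  exact (Nat.find_spec (h.exists_separated a (h.slopes a k))).2

theorem strictMono_slopes (h : IsTangentSystem Φ τ) (a : ℝ) : StrictMono (h.slopes a) :=
  strictMono_nat_of_lt_succ (h.slopes_lt_succ a)

theorem not_separated_of_lt_slopes (h : IsTangentSystem Φ τ) (a : ℝ) (k p : ℕ)
    (h1 : h.slopes a k < p) (h2 : p < h.slopes a (k + 1)) :
    ¬ Separated Φ τ a (h.slopes a k) p := by
  classical
  intro hs
  exact Nat.find_min (h.exists_separated a (h.slopes a k)) h2 ⟨h1, hs⟩

/-- The difference of two lines is monotone, so a gap at a contact point persists beyond it, and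
consecutive gaps add up. -/
theorem supportLine_slopes_le_left (h : IsTangentSystem Φ τ) (hτ : Monotone τ) (a : ℝ) {k j : ℕ}
    (hkj : k ≤ j) {t : ℝ} (ht : τ (h.slopes a j) ≤ t) :
    supportLine Φ τ (h.slopes a k) t + a * (j - k : ℕ) ≤ supportLine Φ τ (h.slopes a j) t := by
  induction j, hkj using Nat.le_induction with
  | base => simp
  | succ j hkj ih =>
    have h1 := ih ((hτ (h.slopes_lt_succ a j).le).trans ht)
    have h2 := supportLine_sub_mono Φ τ (h.slopes_lt_succ a j).le ht
    have h3 := (h.separated_slopes a j).2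
    rw [supportLine_self] at h2
    rw [Nat.succ_sub hkj]
    push_cast
    linarith

theorem supportLine_slopes_le_right (h : IsTangentSystem Φ τ) (hτ : Monotone τ) (a : ℝ) {k j : ℕ}
    (hkj : j ≤ k) {t : ℝ} (ht : t ≤ τ (h.slopes a j)) :
    supportLine Φ τ (h.slopes a k) t + a * (k - j : ℕ) ≤ supportLine Φ τ (h.slopes a j) t := by
  induction k, hkj using Nat.le_induction with
  | base => simp
  | succ k hkj ih =>
    have ht' : t ≤ τ (h.slopes a k) := ht.trans (hτ ((h.strictMono_slopes a).monotone hkj))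
    have h2 := supportLine_sub_mono Φ τ (h.slopes_lt_succ a k).le ht'
    have h3 := (h.separated_slopes a k).1
    rw [supportLine_self] at h2
    rw [Nat.succ_sub hkj]
    push_cast
    linarith

/-- The index j is chosen so that t lies between the contact points of lines j and j + 1, or j = 0
left of the first. With truncated subtraction, `(j - k) + (k - (j + 1))` is the distance from k to
{j, j + 1}. The point `max t (-1)` is needed because Φ is controlled only on [-1, 0). -/
theorem exists_index (h : IsTangentSystem Φ τ) (hτ : Monotone τ) {a : ℝ} (ha : 0 ≤ a) {t : ℝ}
    (ht : t < 0) : ∃ j, ∀ M, M = max (supportLine Φ τ (h.slopes a j) t)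
        (supportLine Φ τ (h.slopes a (j + 1)) t) →
      (∀ k, supportLine Φ τ (h.slopes a k) t + a * ((j - k) + (k - (j + 1)) : ℕ) ≤ M) ∧
      M ≤ Φ (max t (-1)) ∧ Φ (max t (-1)) ≤ M + (a + 1) := by
  classical
  have hex : ∃ k, t < τ (h.slopes a k) := by
    have h1 := h.eventually_le_contact (T := t / 2) (by linarith)
    obtain ⟨n, hn⟩ := ((h.strictMono_slopes a).tendsto_atTop.eventually h1).exists
    exact ⟨n, by linarith⟩
  set y := max t (-1) with hy
  have hym : y ∈ Set.Ico (-1 : ℝ) 0 := ⟨le_max_right _ _, max_lt ht (by norm_num)⟩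
  have hty : t ≤ y := le_max_left _ _
  have hupper : ∀ j, max (supportLine Φ τ (h.slopes a j) t)
        (supportLine Φ τ (h.slopes a (j + 1)) t) ≤ Φ y := fun j =>
    max_le ((supportLine_mono Φ τ _ hty).trans (h.supportLine_le _ hym))
      ((supportLine_mono Φ τ _ hty).trans (h.supportLine_le _ hym))
  rcases hfind : Nat.find hex with _ | j
  -- Up to the first contact point Φ equals its minimum `Φ (-1)`, which is the constant line of
  -- slope 0.
  · have h0 : t < τ (h.slopes a 0) := hfind ▸ Nat.find_spec hex
    have h01 : t ≤ τ (h.slopes a 1) := h0.le.trans (hτ (h.slopes_lt_succ a 0).le)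
    refine ⟨0, fun M hM => ⟨fun k => ?_, hM ▸ hupper 0, ?_⟩⟩
    · rcases k with _ | k
      · rw [hM]; simp
      · rw [hM]
        refine le_trans ?_ (le_max_right _ _)
        have := h.supportLine_slopes_le_right hτ a (k := k + 1) (j := 1) (by omega) h01
        simpa using this
    · have h1 : Φ y ≤ Φ (-1) := by
        have h2 := h.isMin 0 (-1) neg_one_mem
        have h3 := h.monotoneOn hym (h.mem 0) (max_le h0.le (h.mem 0).1)
        push_cast at h2
        linarith
      have h2 : Φ (-1) ≤ M := by
        rw [hM, ← h.supportLine_zero t]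
        exact le_max_left _ _
      linarith
  · have h1 : t < τ (h.slopes a (j + 1)) := hfind ▸ Nat.find_spec hex
    have h2 : τ (h.slopes a j) ≤ t := not_lt.1 (Nat.find_min hex (by omega))
    have hyt : y = t := max_eq_left ((h.mem _).1.trans h2)
    refine ⟨j, fun M hM => ⟨fun k => ?_, hM ▸ hupper j, ?_⟩⟩
    · rw [hM]
      rcases le_or_gt k j with hkj | hkj
      · refine le_trans ?_ (le_max_left _ _)
        have := h.supportLine_slopes_le_left hτ a hkj h2
        rwa [Nat.sub_eq_zero_of_le (by omega : k ≤ j + 1), Nat.add_zero]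
      · refine le_trans ?_ (le_max_right _ _)
        have := h.supportLine_slopes_le_right hτ a (Nat.succ_le_iff.2 hkj) h1.le
        rwa [Nat.sub_eq_zero_of_le hkj.le, Nat.zero_add]
    · rw [hM, hyt]
      exact h.le_max_supportLine ha (h.slopes_lt_succ a j)
        (fun p hp1 hp2 => h.not_separated_of_lt_slopes a j p hp1 hp2) ⟨h2, h1.le⟩

end IsTangentSystem

/-! ### From supporting lines to monomials. -/

/-- With t = log r, a line of slope n becomes a monomial of degree n, and an additive gap log A
becomes a factor A. -/
theorem exists_separated_monomials {v : ℝ → ℝ} (hv : IsLogConvexWeight v)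
    (hunb : ∀ K, ∃ r ∈ Set.Ico (0 : ℝ) 1, K < v r) {A : ℝ} (hA : 1 ≤ A) :
    ∃ (n : ℕ → ℕ) (b : ℕ → ℝ) (C : ℝ), StrictMono n ∧ (∀ k, 0 < b k) ∧ 0 < C ∧
      ∀ r ∈ Set.Ioo (0 : ℝ) 1, ∃ j, ∀ M, M = max (b j * r ^ n j) (b (j + 1) * r ^ n (j + 1)) →
        (∀ k, b k * r ^ n k * A ^ ((j - k) + (k - (j + 1))) ≤ M) ∧ M ≤ C * v r ∧ v r ≤ C * M := by
  set Φ : ℝ → ℝ := fun t => Real.log (v (Real.exp t)) with hΦ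
  have hmaps : ∀ t < 0, Real.exp t ∈ Set.Ico (0 : ℝ) 1 := fun t ht =>
    ⟨(Real.exp_pos t).le, Real.exp_lt_one_iff.2 ht⟩
  have hvpos : ∀ t < 0, 0 < v (Real.exp t) := fun t ht => hv.pos _ (hmaps t ht)
  have hexpΦ : ∀ t < 0, Real.exp (Φ t) = v (Real.exp t) := fun t ht => Real.exp_log (hvpos t ht)
  have hcont : ContinuousOn Φ (Set.Ico (-1) 0) := by
    refine ContinuousOn.log ?_ fun t ht => (hvpos t ht.2).ne'
    exact hv.continuousOn.comp Real.continuous_exp.continuousOn fun t ht => hmaps t ht.2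
  have hconv : ConvexOn ℝ (Set.Ico (-1) 0) Φ :=
    hv.convexOn_log.subset (fun t ht => ht.2) (convex_Ico _ _)
  have hmono : MonotoneOn Φ (Set.Ico (-1) 0) := fun s hs t ht hst =>
    Real.log_le_log (hvpos s hs.2)
      (hv.monotoneOn (hmaps s hs.2) (hmaps t ht.2) (Real.exp_le_exp.2 hst))
  have hunb' : ∀ K, ∃ t ∈ Set.Ico (-1 : ℝ) 0, K < Φ t := by
    intro K
    obtain ⟨r, hr, hK⟩ := hunb (max (Real.exp K) (v (Real.exp (-1))))
    have h1 : Real.exp (-1) < r := by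
      by_contra! hle
      have := hv.monotoneOn hr (hmaps (-1) (by norm_num)) hle
      exact absurd ((le_max_right _ _).trans_lt hK) (not_lt.2 this)
    have hr0 : 0 < r := (Real.exp_pos _).trans h1
    refine ⟨Real.log r, ⟨((Real.lt_log_iff_exp_lt hr0).2 h1).le, Real.log_neg hr0 hr.2⟩, ?_⟩
    simp only [hΦ, Real.exp_log hr0]
    rw [Real.lt_log_iff_exp_lt (hv.pos r hr)]
    exact (le_max_left _ _).trans_lt hK
  obtain ⟨τ, hτ⟩ := exists_isTangentSystem hcont hconv hmono hunb'
  set a := Real.log A with ha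
  have hA0 : 0 < A := by linarith
  have ha0 : 0 ≤ a := Real.log_nonneg hA
  have hexp : ∀ n : ℕ, ∀ r : ℝ, 0 < r → Real.exp (supportLine Φ τ n (Real.log r)) =
      Real.exp (Φ (τ n) - n * τ n) * r ^ n := by
    intro n r hr
    rw [supportLine, Real.exp_add, ← Real.log_pow, Real.exp_log (by positivity), mul_comm]
  have h0mem : (0 : ℝ) ∈ Set.Ico (0 : ℝ) 1 := by simp
  have h1mem := hmaps (-1) (by norm_num)
  have hv0 := hv.pos 0 h0mem
  -- Bounds the variation of `v` on [0, 1/e], where the supporting lines give no information.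
  set D := v (Real.exp (-1)) / v 0 with hD
  have hD1 : 1 ≤ D := by
    rw [hD, one_le_div hv0]
    exact hv.monotoneOn h0mem h1mem (Real.exp_pos _).le
  refine ⟨hτ.slopes a, fun k => Real.exp (Φ (τ (hτ.slopes a k)) - hτ.slopes a k * τ (hτ.slopes a k)),
    D * Real.exp (a + 1), hτ.strictMono_slopes a, fun k => Real.exp_pos _, by positivity, ?_⟩
  intro r hr
  have hlog := Real.log_neg hr.1 hr.2
  obtain ⟨j, hj⟩ := hτ.exists_index hτ.contact_mono ha0 hlog
  obtain ⟨hj1, hj2, hj3⟩ := hj _ rfl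
  refine ⟨j, fun M hM => ?_⟩
  rw [← hexp _ r hr.1, ← hexp _ r hr.1, ← Real.exp_monotone.map_max] at hM
  have hmax0 : max (Real.log r) (-1) < 0 := max_lt hlog (by norm_num)
  have hrv : v r ≤ v (Real.exp (max (Real.log r) (-1))) := by
    refine hv.monotoneOn ⟨hr.1.le, hr.2⟩ (hmaps _ hmax0) ?_
    rw [← Real.log_le_iff_le_exp hr.1]
    exact le_max_left _ _
  have hvr : v (Real.exp (max (Real.log r) (-1))) ≤ D * v r := by
    have hvrpos := hv.pos r ⟨hr.1.le, hr.2⟩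
    rcases le_total (Real.log r) (-1) with h | h
    · rw [max_eq_right h, hD, div_mul_eq_mul_div, le_div_iff₀ hv0]
      exact mul_le_mul_of_nonneg_left (hv.monotoneOn h0mem ⟨hr.1.le, hr.2⟩ hr.1.le)
        (hv.pos _ h1mem).le
    · rw [max_eq_left h, Real.exp_log hr.1]
      nlinarith
  have hvrpos := hv.pos r ⟨hr.1.le, hr.2⟩
  have he1 : 1 ≤ Real.exp (a + 1) := Real.one_le_exp (by linarith)
  refine ⟨fun k => ?_, ?_, ?_⟩
  · rw [← hexp _ r hr.1, hM, show A ^ ((j - k) + (k - (j + 1))) =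
      Real.exp (a * ((j - k) + (k - (j + 1)) : ℕ)) by
        rw [mul_comm, ← Real.log_pow, Real.exp_log (by positivity)], ← Real.exp_add]
    exact Real.exp_le_exp.2 (hj1 k)
  · rw [hM]
    refine (Real.exp_le_exp.2 hj2).trans ?_
    rw [hexpΦ _ hmax0]
    refine hvr.trans ?_
    rw [mul_right_comm]
    exact le_mul_of_one_le_right (by positivity) he1
  · rw [hM]
    refine hrv.trans ?_
    rw [← hexpΦ _ hmax0]
    refine (Real.exp_le_exp.2 hj3).trans ?_
    rw [Real.exp_add, mul_comm, mul_assoc]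
    exact le_mul_of_one_le_left (by positivity) hD1

/-! ### Quasi-norm estimates for geometrically separated series. -/

open scoped ENNReal

theorem tsum_pow_dist_le (s : ℝ≥0∞) (j : ℕ) :
    ∑' k, s ^ ((j - k) + (k - (j + 1))) ≤ 2 * (1 - s)⁻¹ := by
  rw [← ENNReal.summable.sum_add_tsum_nat_add' (k := j + 1) , two_mul, ← ENNReal.tsum_geometric]
  refine add_le_add ?_ (le_of_eq ?_)
  · have : ∑ k ∈ Finset.range (j + 1), s ^ ((j - k) + (k - (j + 1))) =
        ∑ k ∈ Finset.range (j + 1), s ^ k := by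
      rw [← Finset.sum_range_reflect]
      refine Finset.sum_congr rfl fun k hk => ?_
      rw [Finset.mem_range] at hk
      congr 1
      omega
    rw [this]
    exact ENNReal.sum_le_tsum _
  · refine tsum_congr fun k => ?_
    congr 1
    omega

/-- The constant in `lintegral_tsum_rpow_le`. -/
noncomputable def geomConst (q : ℝ) : ℝ≥0∞ := 4 ^ q * (2 * (1 - (2⁻¹ : ℝ≥0∞) ^ q)⁻¹)

theorem geomConst_ne_top {q : ℝ} (hq : 0 < q) : geomConst q ≠ ⊤ := by
  refine ENNReal.mul_ne_top (ENNReal.rpow_ne_top_of_nonneg hq.le (by norm_num))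
    (ENNReal.mul_ne_top (by norm_num) (ENNReal.inv_ne_top.2 (tsub_pos_of_lt ?_).ne'))
  exact ENNReal.rpow_lt_one (ENNReal.inv_lt_one.2 (by norm_num)) hq

/-- A quasi-triangle inequality in `L^q`, `0 < q < ∞`, for series with geometrically decaying
terms. -/
theorem lintegral_tsum_rpow_le {Ω : Type*} [MeasurableSpace Ω] {μ : Measure Ω} {q : ℝ} (hq : 0 < q)
    {g : ℕ → Ω → ℝ≥0∞} (hg : ∀ k, Measurable (g k)) (j : ℕ) (M : ℝ≥0∞)
    (h : ∀ k, ∫⁻ x, g k x ^ q ∂μ ≤ ((4⁻¹ : ℝ≥0∞) ^ ((j - k) + (k - (j + 1))) * M) ^ q) :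
    ∫⁻ x, (∑' k, g k x) ^ q ∂μ ≤ geomConst q * M ^ q := by
  set e : ℕ → ℕ := fun k => (j - k) + (k - (j + 1)) with he
  -- The decay 4^{-e} is split in two: one 2^{-e} sums the series pointwise, the other sums the
  -- integrals. Bounding each term by the whole ℓ^q sum works for q < 1 as well.
  set T : Ω → ℝ≥0∞ := fun x => ∑' k, (2 ^ e k * g k x) ^ q with hT
  have h2 : ∀ m : ℕ, (2⁻¹ : ℝ≥0∞) ^ m * 2 ^ m = 1 := fun m => by
    rw [← mul_pow, ENNReal.inv_mul_cancel (by norm_num) (by norm_num), one_pow]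
  have hpt : ∀ x, (∑' k, g k x) ^ q ≤ 4 ^ q * T x := by
    intro x
    have h1 : ∀ k, g k x ≤ (2⁻¹ : ℝ≥0∞) ^ e k * T x ^ (1 / q) := by
      intro k
      have h3 : 2 ^ e k * g k x ≤ T x ^ (1 / q) := by
        rw [one_div, ENNReal.le_rpow_inv_iff hq]
        exact ENNReal.le_tsum (f := fun k => (2 ^ e k * g k x) ^ q) k
      calc g k x = (2⁻¹ : ℝ≥0∞) ^ e k * (2 ^ e k * g k x) := by rw [← mul_assoc, h2, one_mul]
        _ ≤ _ := by gcongr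
    have h4 : ∑' k, g k x ≤ 4 * T x ^ (1 / q) := by
      refine (ENNReal.tsum_le_tsum h1).trans ?_
      rw [ENNReal.tsum_mul_right]
      gcongr
      refine (tsum_pow_dist_le _ _).trans (le_of_eq ?_)
      rw [ENNReal.one_sub_inv_two, inv_inv]
      norm_num
    calc (∑' k, g k x) ^ q ≤ (4 * T x ^ (1 / q)) ^ q := by gcongr
      _ = 4 ^ q * T x := by
        rw [ENNReal.mul_rpow_of_nonneg _ _ hq.le, ← ENNReal.rpow_mul, one_div_mul_cancel hq.ne',
          ENNReal.rpow_one]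
  refine (lintegral_mono hpt).trans ?_
  have hTk : ∀ k, Measurable fun x => (2 ^ e k * g k x) ^ q := fun k =>
    ((hg k).const_mul _).pow_const q
  rw [lintegral_const_mul _ (Measurable.tsum hTk), lintegral_tsum
    fun k => (hTk k).aemeasurable, geomConst, mul_assoc]
  gcongr
  have h5 : ∀ k, ∫⁻ x, (2 ^ e k * g k x) ^ q ∂μ ≤ ((2⁻¹ : ℝ≥0∞) ^ q) ^ e k * M ^ q := by
    intro k
    simp only [ENNReal.mul_rpow_of_nonneg _ _ hq.le]
    rw [lintegral_const_mul _ ((hg k).pow_const q)]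
    refine (mul_le_mul_right (h k) _).trans (le_of_eq ?_)
    rw [← ENNReal.mul_rpow_of_nonneg _ _ hq.le, ← mul_assoc, ← mul_pow,
      show (2 : ℝ≥0∞) * 4⁻¹ = 2⁻¹ by
        rw [show (4 : ℝ≥0∞) = 2 * 2 by norm_num,
          ENNReal.mul_inv (by norm_num) (by norm_num), ← mul_assoc,
          ENNReal.mul_inv_cancel (by norm_num) (by norm_num), one_mul],
      ENNReal.mul_rpow_of_nonneg _ _ hq.le, ← ENNReal.rpow_natCast, ← ENNReal.rpow_natCast,
      ← ENNReal.rpow_mul, ← ENNReal.rpow_mul, mul_comm q]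
  refine (ENNReal.tsum_le_tsum h5).trans ?_
  rw [ENNReal.tsum_mul_right]
  gcongr
  exact tsum_pow_dist_le _ _

theorem enorm_le_enorm_add_tsum {u : ℕ → ℂ} {s : ℂ} (hu : HasSum u s) (i : ℕ) :
    ‖u i‖ₑ ≤ ‖s‖ₑ + ∑' k, ‖if k = i then 0 else u k‖ₑ := by
  have h := hasSum_ite_sub_hasSum hu i
  have h1 : ‖s - u i‖ₑ ≤ ∑' k, ‖if k = i then 0 else u k‖ₑ := by
    rw [← h.tsum_eq]; exact enorm_tsum_le_tsum_enorm
  calc ‖u i‖ₑ = ‖s - (s - u i)‖ₑ := by rw [sub_sub_cancel]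
    _ ≤ ‖s‖ₑ + ‖s - u i‖ₑ := enorm_sub_le
    _ ≤ _ := by gcongr

theorem ENNReal.add_add_rpow_le {q : ℝ} (hq : 0 < q) (a b c : ℝ≥0∞) :
    (a + b + c) ^ q ≤ 3 ^ q * (a ^ q + b ^ q + c ^ q) := by
  set m := max (max a b) c with hm
  have h1 : a + b + c ≤ 3 * m := by
    have ha : a ≤ m := (le_max_left _ _).trans (le_max_left _ _)
    have hb : b ≤ m := (le_max_right _ _).trans (le_max_left _ _)
    have hc : c ≤ m := le_max_right _ _
    calc a + b + c ≤ m + m + m := by gcongr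
      _ = 3 * m := by ring
  have h2 : m ^ q ≤ a ^ q + b ^ q + c ^ q := by
    rcases le_total (max a b) c with h | h
    · rw [hm, max_eq_right h]; exact le_add_self
    · rw [hm, max_eq_left h]
      rcases le_total a b with h' | h'
      · rw [max_eq_right h']; exact le_add_self.trans le_self_add
      · rw [max_eq_left h']; exact le_self_add.trans le_self_add
  calc (a + b + c) ^ q ≤ (3 * m) ^ q := by gcongr
    _ = 3 ^ q * m ^ q := ENNReal.mul_rpow_of_nonneg _ _ hq.le
    _ ≤ _ := by gcongr

/-- A single rotation that tells two degrees apart; it replaces a Fourier projection, which would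
not be bounded for q < 1. -/
theorem exists_rotation_pow_eq_neg {m n : ℕ} (h : m < n) : ∃ ω : ℂ, ‖ω‖ = 1 ∧ ω ^ n = -ω ^ m := by
  refine ⟨Complex.exp ((Real.pi / (n - m : ℕ) : ℝ) * Complex.I), Complex.norm_exp_ofReal_mul_I _, ?_⟩
  have hnm : ((n - m : ℕ) : ℂ) ≠ 0 := Nat.cast_ne_zero.2 (by omega)
  have h1 : Complex.exp ((Real.pi / (n - m : ℕ) : ℝ) * Complex.I) ^ (n - m) = -1 := by
    rw [← Complex.exp_nat_mul, ← Complex.exp_pi_mul_I]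
    congr 1
    push_cast
    field_simp
  rw [show n = (n - m) + m by omega, pow_add, Nat.add_sub_cancel, h1, neg_one_mul]

theorem lintegral_norm_rpow_rotation {d : ℕ} (q : ℝ) (F : CSpace d → ℂ) {ω : ℂ} (hω : ‖ω‖ = 1) :
    ∫⁻ z, ‖F (ω • z)‖ₑ ^ q ∂normalizedVolume d = ∫⁻ z, ‖F z‖ₑ ^ q ∂normalizedVolume d := by
  have hω0 : ω ≠ 0 := by rintro rfl; simp at hω
  exact (measurePreserving_rotation d hω).lintegral_comp_emb
    (Homeomorph.smulOfNeZero ω hω0).measurableEmbedding (fun z => ‖F z‖ₑ ^ q)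

/-! ### Two-sided bounds for sums of homogeneous terms. -/

/-- A sum of homogeneous terms. -/
structure IsHomogeneousSum {d : ℕ} (n : ℕ → ℕ) (X : ℕ → CSpace d → ℂ) (F : CSpace d → ℂ) :
    Prop where
  measurable : ∀ k, Measurable (X k)
  aestronglyMeasurable : AEStronglyMeasurable F (normalizedVolume d)
  homogeneous : ∀ k (ω : ℂ) z, X k (ω • z) = ω ^ n k * X k z
  hasSum : ∀ z ∈ cBall d 1, HasSum (fun k => X k z) (F z)

namespace IsHomogeneousSum

variable {d : ℕ} {n : ℕ → ℕ} {X : ℕ → CSpace d → ℂ} {F : CSpace d → ℂ}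

theorem lintegral_le (hX : IsHomogeneousSum n X F) {q : ℝ} (hq : 0 < q) (j : ℕ) (M : ℝ≥0∞)
    (h : ∀ k, ∫⁻ z, ‖X k z‖ₑ ^ q ∂normalizedVolume d ≤
      ((4⁻¹ : ℝ≥0∞) ^ ((j - k) + (k - (j + 1))) * M) ^ q) :
    ∫⁻ z, ‖F z‖ₑ ^ q ∂normalizedVolume d ≤ geomConst q * M ^ q := by
  refine le_trans (lintegral_mono_ae ?_)
    (lintegral_tsum_rpow_le hq (fun k => (hX.measurable k).enorm) j M h)
  filter_upwards [ae_mem_cBall d] with z hz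
  rw [← (hX.hasSum z hz).tsum_eq]
  gcongr
  exact enorm_tsum_le_tsum_enorm

/-- If the rotation by `ω` distinguishes the homogeneous degrees `n i` and `n i'`, then the `i`-th
term is controlled by the sum and by the terms other than the `i`-th and the `i'`-th one. -/
theorem lintegral_term_le (hX : IsHomogeneousSum n X F) {q : ℝ} (hq : 0 < q) {i i' : ℕ} {ω : ℂ}
    (hω : ‖ω‖ = 1) (hi : ω ^ n i = -ω ^ n i') (j : ℕ) (M : ℝ≥0∞)
    (h : ∀ k, k ≠ i → k ≠ i' → ∫⁻ z, ‖X k z‖ₑ ^ q ∂normalizedVolume d ≤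
      ((4⁻¹ : ℝ≥0∞) ^ ((j - k) + (k - (j + 1))) * M) ^ q) :
    2 ^ q * ∫⁻ z, ‖X i z‖ₑ ^ q ∂normalizedVolume d ≤
      3 ^ q * (2 * ∫⁻ z, ‖F z‖ₑ ^ q ∂normalizedVolume d + 2 ^ q * (geomConst q * M ^ q)) := by
  have hωe : ‖ω‖ₑ = 1 := by rw [← ofReal_norm, hω, ENNReal.ofReal_one]
  set u : ℕ → CSpace d → ℂ := fun k z =>
    if k = i then 0 else (ω ^ n i' - ω ^ n k) * X k z with hu
  have hum : ∀ k, Measurable (u k) := by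
    intro k
    by_cases hk : k = i
    · simp [hu, hk]
    · simp only [hu, hk, if_false]; exact (hX.measurable k).const_mul _
  have hcoef : ∀ k, ‖ω ^ n i' - ω ^ n k‖ₑ ≤ 2 := fun k => by
    refine enorm_sub_le.trans (le_of_eq ?_)
    rw [enorm_pow, enorm_pow, hωe, one_pow, one_pow]; norm_num
  have hpt : ∀ z ∈ cBall d 1, 2 * ‖X i z‖ₑ ≤ ‖F z‖ₑ + ‖F (ω • z)‖ₑ + ∑' k, ‖u k z‖ₑ := by
    intro z hz
    -- In ω^{n i'} F(z) - F(ω z) the `i'`-th term cancels and the `i`-th is doubled in modulus.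
    have h1 := (hX.hasSum z hz).mul_left (ω ^ n i')
    have h2 := hX.hasSum _ (smul_mem_cBall hω.le hz)
    simp only [hX.homogeneous] at h2
    have h3 := h1.sub h2
    simp only [← sub_mul] at h3
    have h4 := enorm_le_enorm_add_tsum h3 i
    have h5 : ‖(ω ^ n i' - ω ^ n i) * X i z‖ₑ = 2 * ‖X i z‖ₑ := by
      rw [hi, sub_neg_eq_add, ← two_mul, enorm_mul, enorm_mul, enorm_pow, hωe, one_pow, mul_one]
      congr 1
      rw [← ofReal_norm]; simp
    rw [h5] at h4
    refine h4.trans ?_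
    gcongr
    refine enorm_sub_le.trans (le_of_eq ?_)
    rw [enorm_mul, enorm_pow, hωe, one_pow, one_mul]
  have hFω : AEMeasurable (fun z => ‖F (ω • z)‖ₑ ^ q) (normalizedVolume d) :=
    ((hX.aestronglyMeasurable.comp_measurePreserving
      (measurePreserving_rotation d hω)).enorm).pow_const q
  have hFm : AEMeasurable (fun z => ‖F z‖ₑ ^ q) (normalizedVolume d) :=
    hX.aestronglyMeasurable.enorm.pow_const q
  calc 2 ^ q * ∫⁻ z, ‖X i z‖ₑ ^ q ∂normalizedVolume d
      = ∫⁻ z, (2 * ‖X i z‖ₑ) ^ q ∂normalizedVolume d := by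
        simp only [ENNReal.mul_rpow_of_nonneg _ _ hq.le]
        rw [lintegral_const_mul _ ((hX.measurable i).enorm.pow_const q)]
    _ ≤ ∫⁻ z, 3 ^ q * (‖F z‖ₑ ^ q + ‖F (ω • z)‖ₑ ^ q + (∑' k, ‖u k z‖ₑ) ^ q)
        ∂normalizedVolume d := by
        refine lintegral_mono_ae ?_
        filter_upwards [ae_mem_cBall d] with z hz
        refine le_trans ?_ (ENNReal.add_add_rpow_le hq _ _ _)
        gcongr
        exact hpt z hz
    _ = 3 ^ q * (2 * ∫⁻ z, ‖F z‖ₑ ^ q ∂normalizedVolume d +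
          ∫⁻ z, (∑' k, ‖u k z‖ₑ) ^ q ∂normalizedVolume d) := by
        rw [lintegral_const_mul' _ _ (ENNReal.rpow_ne_top_of_nonneg hq.le (by norm_num)),
          lintegral_add_left' (f := fun z => ‖F z‖ₑ ^ q + ‖F (ω • z)‖ₑ ^ q) (hFm.add hFω), lintegral_add_left' hFm,
          lintegral_norm_rpow_rotation q F hω, two_mul]
    _ ≤ _ := by
        gcongr
        rw [show (2 : ℝ≥0∞) ^ q * (geomConst q * M ^ q) = geomConst q * (2 * M) ^ q by
          rw [ENNReal.mul_rpow_of_nonneg _ _ hq.le, mul_left_comm]]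
        refine lintegral_tsum_rpow_le hq (fun k => (hum k).enorm) j (2 * M) fun k => ?_
        by_cases hk : k = i
        · simp [hu, hk, ENNReal.zero_rpow_of_pos hq]
        by_cases hk' : k = i'
        · simp [hu, hk', ENNReal.zero_rpow_of_pos hq]
        simp only [hu, hk, if_false]
        calc ∫⁻ z, ‖(ω ^ n i' - ω ^ n k) * X k z‖ₑ ^ q ∂normalizedVolume d
            ≤ ∫⁻ z, 2 ^ q * ‖X k z‖ₑ ^ q ∂normalizedVolume d := by
              refine lintegral_mono fun z => ?_
              rw [enorm_mul, ENNReal.mul_rpow_of_nonneg _ _ hq.le]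
              gcongr
              exact hcoef k
          _ = 2 ^ q * ∫⁻ z, ‖X k z‖ₑ ^ q ∂normalizedVolume d :=
              lintegral_const_mul _ ((hX.measurable k).enorm.pow_const q)
          _ ≤ 2 ^ q * ((4⁻¹ : ℝ≥0∞) ^ ((j - k) + (k - (j + 1))) * M) ^ q := by
              gcongr; exact h k hk hk'
          _ = _ := by rw [← ENNReal.mul_rpow_of_nonneg _ _ hq.le, mul_left_comm]

/-- The upper bound is the quasi-triangle inequality. For the lower bound the larger dominant term
is isolated by a rotation; all terms other than j and j + 1 carry an extra factor 1/B. -/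
theorem two_sided (hX : IsHomogeneousSum n X F) (hn : StrictMono n) {q : ℝ} (hq : 0 < q)
    {B : ℝ≥0∞} (hB1 : 1 ≤ B) (hBtop : B ≠ ⊤) (hB : 2 * (3 ^ q * geomConst q) ≤ B ^ q) {x : ℕ → ℝ≥0∞}
    (hx : ∀ k, ∫⁻ z, ‖X k z‖ₑ ^ q ∂normalizedVolume d = x k ^ q) (j : ℕ) {M : ℝ≥0∞}
    (hM : M = max (x j) (x (j + 1))) (hMtop : M ≠ ⊤)
    (hxM : ∀ k, x k * (4 * B) ^ ((j - k) + (k - (j + 1))) ≤ M) :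
    ∫⁻ z, ‖F z‖ₑ ^ q ∂normalizedVolume d ≤ geomConst q * M ^ q ∧
      2 ^ q * M ^ q ≤ 2 * (3 ^ q * (2 * ∫⁻ z, ‖F z‖ₑ ^ q ∂normalizedVolume d)) := by
  have h4 : ∀ m : ℕ, (4⁻¹ : ℝ≥0∞) ^ m * 4 ^ m = 1 := fun m => by
    rw [← mul_pow, ENNReal.inv_mul_cancel (by norm_num) (by norm_num), one_pow]
  have hB0 : B ≠ 0 := (zero_lt_one.trans_le hB1).ne'
  constructor
  · refine hX.lintegral_le hq j M fun k => ?_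
    rw [hx]
    gcongr
    refine le_trans ?_ (mul_le_mul_right (hxM k) _)
    rw [mul_pow, mul_left_comm, ← mul_assoc ((4⁻¹ : ℝ≥0∞) ^ _), h4, one_mul]
    exact le_mul_of_one_le_right' (one_le_pow₀ hB1)
  · obtain ⟨ω, hω, hωn⟩ := exists_rotation_pow_eq_neg (hn (Nat.lt_succ_self j))
    obtain ⟨i, i', hii, hxi, hωi⟩ : ∃ i i', ((i = j ∧ i' = j + 1) ∨ (i = j + 1 ∧ i' = j)) ∧
        x i = M ∧ ω ^ n i = -ω ^ n i' := by
      rcases le_total (x j) (x (j + 1)) with h | h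
      · exact ⟨j + 1, j, Or.inr ⟨rfl, rfl⟩, by rw [hM, max_eq_right h], hωn⟩
      · exact ⟨j, j + 1, Or.inl ⟨rfl, rfl⟩, by rw [hM, max_eq_left h], by
          rw [show n (j + 1) = n j.succ from rfl, hωn, neg_neg]⟩
    have hkey := hX.lintegral_term_le hq hω hωi j (M / B) fun k hk hk' => by
      rw [hx]
      gcongr
      have hd : 1 ≤ (j - k) + (k - (j + 1)) := by omega
      set e := (j - k) + (k - (j + 1)) with he
      have h1 : x k * (4 ^ e * B) ≤ M := by
        refine le_trans ?_ (hxM k)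
        rw [mul_pow]
        gcongr
        exact le_self_pow₀ hB1 (by omega)
      calc x k = (4⁻¹ : ℝ≥0∞) ^ e * (x k * 4 ^ e) := by rw [mul_left_comm, h4, mul_one]
        _ ≤ _ := by
          gcongr
          rw [ENNReal.le_div_iff_mul_le (Or.inl hB0) (Or.inl hBtop), mul_assoc]
          exact h1
    rw [hx, hxi] at hkey
    set a := (2 : ℝ≥0∞) ^ q * M ^ q with ha
    have hatop : a ≠ ⊤ := ENNReal.mul_ne_top (ENNReal.rpow_ne_top_of_nonneg hq.le (by norm_num))
      (ENNReal.rpow_ne_top_of_nonneg hq.le hMtop)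
    -- `hB` is made for this: the remainder is at most half of the left side and is absorbed.
    have hsmall : 3 ^ q * (2 ^ q * (geomConst q * (M / B) ^ q)) ≤ a / 2 := by
      rw [ENNReal.div_rpow_of_nonneg _ _ hq.le, ENNReal.le_div_iff_mul_le (by simp) (by simp)]
      have hBq0 : B ^ q ≠ 0 := by simp [hB0, hq, hBtop]
      have hBqtop : B ^ q ≠ ⊤ := ENNReal.rpow_ne_top_of_nonneg hq.le hBtop
      calc 3 ^ q * (2 ^ q * (geomConst q * (M ^ q / B ^ q))) * 2
          = (2 * (3 ^ q * geomConst q)) * (2 ^ q * (M ^ q / B ^ q)) := by ring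
        _ ≤ B ^ q * (2 ^ q * (M ^ q / B ^ q)) := by gcongr
        _ = 2 ^ q * (B ^ q * (M ^ q / B ^ q)) := by ring
        _ = a := by rw [ENNReal.mul_div_cancel hBq0 hBqtop]
    rw [mul_add] at hkey
    have h6 : a / 2 + a / 2 ≤ 3 ^ q * (2 * ∫⁻ z, ‖F z‖ₑ ^ q ∂normalizedVolume d) + a / 2 := by
      rw [ENNReal.add_halves]
      exact hkey.trans (by gcongr)
    have h7 := ENNReal.le_of_add_le_add_right
      (ENNReal.div_ne_top hatop (by norm_num)) h6
    rw [ENNReal.div_le_iff_le_mul (by simp) (by simp)] at h7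
    rwa [mul_comm]

end IsHomogeneousSum

/-! ### Normalized monomials and the lacunary series. -/

/-- The `L^q` quasi-norm of the monomial `z i ^ m` over the unit ball. -/
noncomputable def monomialNorm {d : ℕ} (i : Fin d) (q : ℝ) (m : ℕ) : ℝ :=
  (∫⁻ z, ‖z i ^ m‖ₑ ^ q ∂normalizedVolume d).toReal ^ (1 / q)

theorem norm_apply_le_one {d : ℕ} (i : Fin d) {z : CSpace d} (hz : z ∈ cBall d 1) :
    ‖z i‖ < 1 := by
  rw [cBall, mem_ball_zero_iff] at hz
  exact (PiLp.norm_apply_le z i).trans_lt hz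

theorem measurable_apply {d : ℕ} (i : Fin d) : Measurable fun z : CSpace d => z i :=
  Continuous.measurable (by fun_prop)

theorem lintegral_monomial_ne_top {d : ℕ} (i : Fin d) {q : ℝ} (hq : 0 < q) (m : ℕ) :
    ∫⁻ z, ‖z i ^ m‖ₑ ^ q ∂normalizedVolume d ≠ ⊤ := by
  refine ((lintegral_mono_ae (g := fun _ => 1) ?_).trans_lt (by simp)).ne
  filter_upwards [ae_mem_cBall d] with z hz
  refine ENNReal.rpow_le_one ?_ hq.le
  rw [enorm_pow]
  refine pow_le_one₀ zero_le ?_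
  rw [← ofReal_norm, ENNReal.ofReal_le_one]
  exact (norm_apply_le_one i hz).le

theorem ofReal_monomialNorm_rpow {d : ℕ} (i : Fin d) {q : ℝ} (hq : 0 < q) (m : ℕ) :
    ENNReal.ofReal (monomialNorm i q m) ^ q = ∫⁻ z, ‖z i ^ m‖ₑ ^ q ∂normalizedVolume d := by
  rw [ENNReal.ofReal_rpow_of_nonneg (by unfold monomialNorm; positivity) hq.le, monomialNorm,
    ← Real.rpow_mul ENNReal.toReal_nonneg, one_div_mul_cancel hq.ne', Real.rpow_one,
    ENNReal.ofReal_toReal (lintegral_monomial_ne_top i hq m)]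

/-- The set where |z_i| > ρ has positive measure. Thus these norms decay more slowly than any
geometric rate, and dividing by them does not shrink the disc of convergence. -/
theorem exists_le_monomialNorm {d : ℕ} (i : Fin d) {q : ℝ} (hq : 0 < q) {ρ : ℝ} (hρ0 : 0 < ρ)
    (hρ1 : ρ < 1) : ∃ κ, 0 < κ ∧ ∀ m, κ * ρ ^ m ≤ monomialNorm i q m := by
  set S : Set (CSpace d) := {z | ρ < ‖z i‖} with hS
  have hSo : IsOpen S := isOpen_lt continuous_const (by fun_prop)
  have hSpos : normalizedVolume d S ≠ 0 := by
    rw [normalizedVolume, Measure.smul_apply, Measure.restrict_apply hSo.measurableSet, smul_eq_mul]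
    refine mul_ne_zero (ENNReal.inv_ne_zero.2 (volume_cBall_one_ne_top d)) ?_
    refine ((hSo.inter Metric.isOpen_ball).measure_pos _ ?_).ne'
    have habs : |(ρ + 1) / 2| = (ρ + 1) / 2 := abs_of_pos (by linarith)
    refine ⟨PiLp.single 2 i (((ρ + 1) / 2 : ℝ) : ℂ), ?_, ?_⟩
    · simp only [hS, Set.mem_ofPred_eq, PiLp.single_apply, if_true, Complex.norm_real,
        Real.norm_eq_abs, habs]
      linarith
    · rw [mem_ball_zero_iff, PiLp.norm_single, Complex.norm_real, Real.norm_eq_abs, habs]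
      linarith
  refine ⟨((normalizedVolume d).real S) ^ (1 / q), Real.rpow_pos_of_pos
    (ENNReal.toReal_pos hSpos (measure_ne_top _ _)) _, fun m => ?_⟩
  have h1 : ENNReal.ofReal ((ρ ^ m) ^ q) * normalizedVolume d S ≤
      ∫⁻ z, ‖z i ^ m‖ₑ ^ q ∂normalizedVolume d := by
    rw [← setLIntegral_const]
    refine (setLIntegral_mono' hSo.measurableSet fun z hz => ?_).trans (setLIntegral_le_lintegral _ _)
    rw [← ENNReal.ofReal_rpow_of_nonneg (by positivity) hq.le, ← ofReal_norm, norm_pow]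
    have : ρ ≤ ‖z i‖ := le_of_lt hz
    gcongr
  have h2 := ENNReal.toReal_mono (lintegral_monomial_ne_top i hq m) h1
  rw [ENNReal.toReal_mul, ENNReal.toReal_ofReal (by positivity)] at h2
  have h3 := Real.rpow_le_rpow (by positivity) h2 (show 0 ≤ 1 / q by positivity)
  rw [Real.mul_rpow (by positivity) ENNReal.toReal_nonneg, ← Real.rpow_mul (by positivity),
    mul_one_div_cancel hq.ne', Real.rpow_one, mul_comm] at h3
  exact h3

theorem monomialNorm_pos {d : ℕ} (i : Fin d) {q : ℝ} (hq : 0 < q) (m : ℕ) :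
    0 < monomialNorm i q m := by
  obtain ⟨κ, hκ, h⟩ := exists_le_monomialNorm i hq (ρ := 1 / 2) (by norm_num) (by norm_num)
  exact (by positivity : 0 < κ * (1 / 2) ^ m).trans_le (h m)

theorem differentiableOn_tsum_pow {c : ℕ → ℝ} (hc : ∀ k, 0 ≤ c k) {n : ℕ → ℕ}
    (h : ∀ R ∈ Set.Ioo (0 : ℝ) 1, Summable fun k => c k * R ^ n k) :
    DifferentiableOn ℂ (fun ζ : ℂ => ∑' k, (c k : ℂ) * ζ ^ n k) (Metric.ball 0 1) := by
  intro ζ hζ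
  rw [mem_ball_zero_iff] at hζ
  obtain ⟨R, hR1, hR2⟩ := exists_between hζ
  have hR0 : 0 < R := (norm_nonneg ζ).trans_lt hR1
  have := Complex.differentiableOn_tsum_of_summable_norm (h R ⟨hR0, hR2⟩)
    (F := fun k (ζ : ℂ) => (c k : ℂ) * ζ ^ n k) (U := Metric.ball 0 R) (fun k => by fun_prop)
    Metric.isOpen_ball fun k w hw => by
      rw [mem_ball_zero_iff] at hw
      rw [norm_mul, norm_pow, Complex.norm_real, Real.norm_of_nonneg (hc k)]
      have := hc k
      gcongr
  exact (this.differentiableAt (Metric.isOpen_ball.mem_nhds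
    (by rwa [mem_ball_zero_iff]))).differentiableWithinAt

theorem summable_div_monomialNorm {d : ℕ} (i : Fin d) {q : ℝ} (hq : 0 < q) {n : ℕ → ℕ}
    (hn : StrictMono n) {b : ℕ → ℝ} (hb : ∀ k, 0 < b k)
    (h : ∀ r ∈ Set.Ioo (0 : ℝ) 1, ∃ M, ∀ k, b k * r ^ n k ≤ M) {R : ℝ} (hR : R ∈ Set.Ioo (0 : ℝ) 1) :
    Summable fun k => b k / monomialNorm i q (n k) * R ^ n k := by
  -- Bernoulli gives R ≤ s³: one power of s controls `b k`, one the monomial norm, and one sums the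
  -- series.
  set s := 1 - (1 - R) / 3 with hs
  have hs0 : 0 < s := by linarith [hR.1]
  have hs1 : s < 1 := by linarith [hR.2]
  have hRs : R ≤ s ^ 3 := by
    have : R = 1 - 3 * (1 - s) := by rw [hs]; ring
    rw [this]
    nlinarith [mul_nonneg (sq_nonneg (1 - s)) (by linarith : (0 : ℝ) ≤ 2 + s)]
  obtain ⟨M, hM⟩ := h s ⟨hs0, hs1⟩
  obtain ⟨κ, hκ, hκm⟩ := exists_le_monomialNorm i hq hs0 hs1
  have hM0 : 0 ≤ M := le_trans (by have := hb 0; positivity) (hM 0)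
  refine Summable.of_nonneg_of_le (f := fun k => M * κ⁻¹ * s ^ k) (fun k => ?_) (fun k => ?_)
    ((summable_geometric_of_lt_one hs0.le hs1).mul_left _)
  · have := hb k
    have := monomialNorm_pos i hq (n k)
    have := hR.1
    positivity
  · have hbk := hb k
    have hmk := monomialNorm_pos i hq (n k)
    have hR0 := hR.1
    have h1 : s ^ n k / monomialNorm i q (n k) ≤ κ⁻¹ := by
      rw [div_le_iff₀ hmk, le_inv_mul_iff₀ hκ]
      exact hκm (n k)
    have h2 : s ^ n k ≤ s ^ k := pow_le_pow_of_le_one hs0.le hs1.le (hn.le_apply)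
    calc b k / monomialNorm i q (n k) * R ^ n k
        ≤ b k / monomialNorm i q (n k) * (s ^ 3) ^ n k := by gcongr
      _ = (b k * s ^ n k) * (s ^ n k / monomialNorm i q (n k)) * s ^ n k := by
        rw [← pow_mul, mul_comm 3, pow_mul]; ring
      _ ≤ M * κ⁻¹ * s ^ k := by
        have := hM k
        gcongr

theorem aestronglyMeasurable_of_continuousOn {d : ℕ} {F : CSpace d → ℂ}
    (hF : ContinuousOn F (cBall d 1)) : AEStronglyMeasurable F (normalizedVolume d) :=
  (hF.aestronglyMeasurable (measurableSet_cBall d 1)).smul_measure _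

theorem continuousOn_dilation {d : ℕ} {f : CSpace d → ℂ} (hf : IsHolomorphicOnBall d f) {c : ℂ}
    (hc : ‖c‖ ≤ 1) : ContinuousOn (fun z => f (c • z)) (cBall d 1) :=
  hf.continuousOn.comp (by fun_prop) fun _ hz => smul_mem_cBall hc hz

theorem volumeMean_eq_lintegral {d : ℕ} {q : ℝ} (hq : 0 < q) {f : CSpace d → ℂ}
    (hf : IsHolomorphicOnBall d f) {r : ℝ} (hr : r ∈ Set.Ioo (0 : ℝ) 1) :
    volumeMean d q f r =
      (∫⁻ z, ‖f ((r : ℂ) • z)‖ₑ ^ q ∂normalizedVolume d).toReal ^ (1 / q) := by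
  have hr1 : ‖(r : ℂ)‖ ≤ 1 := by
    rw [Complex.norm_real, Real.norm_of_nonneg hr.1.le]; exact hr.2.le
  have hm := aestronglyMeasurable_of_continuousOn (continuousOn_dilation hf hr1)
  rw [volumeMean_eq d q f hr.1 hr.2.le, integral_eq_lintegral_of_nonneg_ae
    (Filter.Eventually.of_forall fun _ => by positivity)
    ((hm.norm.aemeasurable.pow_const q).aestronglyMeasurable)]
  congr 3
  funext z
  rw [← ENNReal.ofReal_rpow_of_nonneg (norm_nonneg _) hq.le, ofReal_norm]

/-- The lacunary series with the coefficients `b k` relative to the normalized monomials of degree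
`n k` in the coordinate `i`. -/
noncomputable def monomialSeries {d : ℕ} (i : Fin d) (q : ℝ) (n : ℕ → ℕ) (b : ℕ → ℝ)
    (z : CSpace d) : ℂ :=
  ∑' k, ((b k / monomialNorm i q (n k) : ℝ) : ℂ) * z i ^ n k

section monomialSeries

variable {d : ℕ} (i : Fin d) {q : ℝ} {n : ℕ → ℕ} {b : ℕ → ℝ}

theorem isHolomorphicOnBall_monomialSeries (hq : 0 < q) (hn : StrictMono n) (hb : ∀ k, 0 < b k)
    (h : ∀ r ∈ Set.Ioo (0 : ℝ) 1, ∃ M, ∀ k, b k * r ^ n k ≤ M) :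
    IsHolomorphicOnBall d (monomialSeries i q n b) := by
  have h1 := differentiableOn_tsum_pow (n := n)
    (fun k => (div_pos (hb k) (monomialNorm_pos i hq (n k))).le)
    (fun R hR => summable_div_monomialNorm i hq hn hb h hR)
  refine h1.comp (g := fun ζ : ℂ => ∑' k, ((b k / monomialNorm i q (n k) : ℝ) : ℂ) * ζ ^ n k)
    (f := fun z : CSpace d => z i) (by fun_prop) fun z hz => ?_
  rw [mem_ball_zero_iff]
  exact norm_apply_le_one i hz

theorem isHomogeneousSum_monomialSeries (hq : 0 < q) (hn : StrictMono n) (hb : ∀ k, 0 < b k)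
    (h : ∀ r ∈ Set.Ioo (0 : ℝ) 1, ∃ M, ∀ k, b k * r ^ n k ≤ M) {r : ℝ}
    (hr : r ∈ Set.Ioo (0 : ℝ) 1) :
    IsHomogeneousSum n
      (fun k (z : CSpace d) => ((b k / monomialNorm i q (n k) : ℝ) : ℂ) * ((r : ℂ) * z i) ^ n k)
      (fun z => monomialSeries i q n b ((r : ℂ) • z)) := by
  have hr1 : ‖(r : ℂ)‖ = r := by rw [Complex.norm_real, Real.norm_of_nonneg hr.1.le]
  refine ⟨fun k => ?_, ?_, fun k ω z => ?_, fun z hz => ?_⟩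
  · exact (((measurable_apply i).const_mul _).pow_const _).const_mul _
  · exact aestronglyMeasurable_of_continuousOn (continuousOn_dilation
      (isHolomorphicOnBall_monomialSeries i hq hn hb h) (hr1.le.trans hr.2.le))
  · simp only [PiLp.smul_apply, smul_eq_mul]
    ring
  · simp only [monomialSeries, PiLp.smul_apply, smul_eq_mul]
    refine Summable.hasSum (Summable.of_norm_bounded
      (summable_div_monomialNorm i hq hn hb h hr) fun k => ?_)
    have hc := (div_pos (hb k) (monomialNorm_pos i hq (n k))).le
    rw [norm_mul, norm_pow, norm_mul, hr1, Complex.norm_real, Real.norm_of_nonneg hc]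
    have := hr.1.le
    gcongr
    exact mul_le_of_le_one_right this (norm_apply_le_one i hz).le

theorem lintegral_monomialSeries_term (hq : 0 < q) (hb : ∀ k, 0 < b k) {r : ℝ} (hr : 0 < r)
    (k : ℕ) :
    ∫⁻ z : CSpace d, ‖((b k / monomialNorm i q (n k) : ℝ) : ℂ) * ((r : ℂ) * z i) ^ n k‖ₑ ^ q
      ∂normalizedVolume d = ENNReal.ofReal (b k * r ^ n k) ^ q := by
  have hm := monomialNorm_pos i hq (n k)
  have hc := (div_pos (hb k) hm).le
  have h1 : ∀ z : CSpace d,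
      ‖((b k / monomialNorm i q (n k) : ℝ) : ℂ) * ((r : ℂ) * z i) ^ n k‖ₑ ^ q =
        ENNReal.ofReal (b k / monomialNorm i q (n k) * r ^ n k) ^ q * ‖z i ^ n k‖ₑ ^ q := by
    intro z
    rw [← ENNReal.mul_rpow_of_nonneg _ _ hq.le, mul_pow, ← mul_assoc, enorm_mul]
    congr 2
    rw [← ofReal_norm, norm_mul, norm_pow, Complex.norm_real, Complex.norm_real,
      Real.norm_of_nonneg hc, Real.norm_of_nonneg hr.le]
  simp only [h1]
  rw [lintegral_const_mul _ ((((measurable_apply i).pow_const _).enorm).pow_const q),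
    ← ofReal_monomialNorm_rpow i hq, ← ENNReal.mul_rpow_of_nonneg _ _ hq.le,
    ← ENNReal.ofReal_mul (by positivity)]
  congr 2
  field_simp

end monomialSeries

/-! ### Equivalence of weights and the conclusion. -/

theorem EquivalentOn.of_le {X : Set ℝ} {u v : ℝ → ℝ} {C D : ℝ} (hC : 0 < C) (hD : 0 < D)
    (h1 : ∀ x ∈ X, u x ≤ C * v x) (h2 : ∀ x ∈ X, v x ≤ D * u x) : EquivalentOn X u v :=
  ⟨C⁻¹, D, inv_pos.2 hC, hD, fun x hx => ⟨by rw [inv_mul_le_iff₀ hC]; exact h1 x hx, h2 x hx⟩⟩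

theorem EquivalentOn.symm {X : Set ℝ} {u v : ℝ → ℝ} (h : EquivalentOn X u v) :
    EquivalentOn X v u := by
  obtain ⟨C, D, hC, hD, h⟩ := h
  refine EquivalentOn.of_le hD (inv_pos.2 hC) (fun x hx => (h x hx).2) fun x hx => ?_
  rw [le_inv_mul_iff₀ hC]
  exact (h x hx).1

theorem EquivalentOn.trans {X : Set ℝ} {u v w : ℝ → ℝ} (h : EquivalentOn X u v)
    (h' : EquivalentOn X v w) : EquivalentOn X u w := by
  obtain ⟨C, D, hC, hD, h⟩ := h
  obtain ⟨C', D', hC', hD', h'⟩ := h'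
  refine ⟨C' * C, D' * D, by positivity, by positivity, fun x hx => ⟨?_, ?_⟩⟩
  · rw [mul_assoc]
    exact (mul_le_mul_of_nonneg_left (h x hx).1 hC'.le).trans (h' x hx).1
  · rw [mul_assoc]
    exact (h' x hx).2.trans (mul_le_mul_of_nonneg_left (h x hx).2 hD'.le)

theorem EquivalentOn.mono {X Y : Set ℝ} {u v : ℝ → ℝ} (h : EquivalentOn X u v) (hYX : Y ⊆ X) :
    EquivalentOn Y u v := by
  obtain ⟨C, D, hC, hD, h⟩ := h
  exact ⟨C, D, hC, hD, fun x hx => h x (hYX hx)⟩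

theorem exists_volumeMean_equivalent_of_bounded (d : ℕ) (q : ℝ) {v : ℝ → ℝ}
    (hv : IsWeight v) {K : ℝ} (hK : ∀ r ∈ Set.Ico (0 : ℝ) 1, v r ≤ K) :
    ∃ f : CSpace d → ℂ, IsHolomorphicOnBall d f ∧
      EquivalentOn (Set.Ioo 0 1) (volumeMean d q f) v := by
  have h0 : (0 : ℝ) ∈ Set.Ico (0 : ℝ) 1 := by simp
  have hone : ∀ r ∈ Set.Ioo (0 : ℝ) 1, volumeMean d q (fun _ => 1) r = 1 := fun r hr => by
    rw [volumeMean_eq d q _ hr.1 hr.2.le]; simp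
  refine ⟨fun _ => 1, differentiableOn_const _, v 0, K, hv.pos 0 h0,
    (hv.pos 0 h0).trans_le (hK 0 h0), fun r hr => ?_⟩
  rw [hone r hr, mul_one, mul_one]
  have hr' : r ∈ Set.Ico (0 : ℝ) 1 := ⟨hr.1.le, hr.2⟩
  exact ⟨hv.monotoneOn h0 hr' hr.1.le, hK r hr'⟩

theorem exists_volumeMean_equivalent_of_unbounded {d : ℕ} (i : Fin d) {q : ℝ} (hq : 0 < q)
    {v : ℝ → ℝ} (hv : IsLogConvexWeight v)
    (hunb : ∀ K, ∃ r ∈ Set.Ico (0 : ℝ) 1, K < v r) :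
    ∃ f : CSpace d → ℂ, IsHolomorphicOnBall d f ∧
      EquivalentOn (Set.Ioo 0 1) (volumeMean d q f) v := by
  -- The least B ≥ 1 for which the remainder in `two_sided` can be absorbed. The separation A = 4B
  -- supplies the decay 1/4 plus this surplus.
  set B : ℝ≥0∞ := max 1 ((2 * (3 ^ q * geomConst q)) ^ (1 / q)) with hB
  have hG := geomConst_ne_top hq
  have h3q : (3 : ℝ≥0∞) ^ q ≠ ⊤ := ENNReal.rpow_ne_top_of_nonneg hq.le (by norm_num)
  have hB1 : 1 ≤ B := le_max_left _ _
  have hBtop : B ≠ ⊤ := by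
    rw [hB]
    refine (max_lt ENNReal.one_lt_top (lt_top_iff_ne_top.2 (ENNReal.rpow_ne_top_of_nonneg
      (by positivity) ?_))).ne
    exact ENNReal.mul_ne_top (by norm_num) (ENNReal.mul_ne_top h3q hG)
  have hBq : 2 * (3 ^ q * geomConst q) ≤ B ^ q := by
    rw [← ENNReal.rpow_inv_le_iff hq, ← one_div]
    exact le_max_right _ _
  have h4Btop : 4 * B ≠ ⊤ := ENNReal.mul_ne_top (by norm_num) hBtop
  set A := (4 * B).toReal with hA
  have hA1 : 1 ≤ A := by
    rw [hA, ← ENNReal.toReal_one]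
    refine ENNReal.toReal_mono h4Btop ?_
    calc (1 : ℝ≥0∞) = 1 * 1 := by ring
      _ ≤ 4 * B := by gcongr; norm_num
  have hAB : ENNReal.ofReal A = 4 * B := ENNReal.ofReal_toReal h4Btop
  obtain ⟨n, b, C, hn, hb, hC, hsep⟩ := exists_separated_monomials hv hunb hA1
  have hbdd : ∀ r ∈ Set.Ioo (0 : ℝ) 1, ∃ M, ∀ k, b k * r ^ n k ≤ M := by
    intro r hr
    obtain ⟨j, hj⟩ := hsep r hr
    refine ⟨_, fun k => le_trans ?_ ((hj _ rfl).1 k)⟩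
    have := hb k
    have := hr.1
    exact le_mul_of_one_le_right (by positivity) (one_le_pow₀ hA1)
  have hhol := isHolomorphicOnBall_monomialSeries i hq hn hb hbdd
  refine ⟨monomialSeries i q n b, hhol, ?_⟩
  have hmain : ∀ r ∈ Set.Ioo (0 : ℝ) 1, ∃ M, 0 ≤ M ∧ M ≤ C * v r ∧ v r ≤ C * M ∧
      volumeMean d q (monomialSeries i q n b) r ≤ (geomConst q).toReal ^ (1 / q) * M ∧
      M ≤ (4 * 3 ^ q) ^ (1 / q) * volumeMean d q (monomialSeries i q n b) r := by
    intro r hr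
    obtain ⟨j, hj⟩ := hsep r hr
    set M := max (b j * r ^ n j) (b (j + 1) * r ^ n (j + 1)) with hM
    obtain ⟨hj1, hj2, hj3⟩ := hj M rfl
    have hM0 : 0 ≤ M := by
      have := hb j
      have := hr.1
      exact le_max_of_le_left (by positivity)
    obtain ⟨hup, hlow⟩ := (isHomogeneousSum_monomialSeries i hq hn hb hbdd hr).two_sided hn hq
      hB1 hBtop hBq (x := fun k => ENNReal.ofReal (b k * r ^ n k))
      (fun k => lintegral_monomialSeries_term i hq hb hr.1 k) j (M := ENNReal.ofReal M)
      (by rw [hM, ENNReal.ofReal_max]) ENNReal.ofReal_ne_top (fun k => by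
        rw [← hAB, ← ENNReal.ofReal_pow (by linarith), ← ENNReal.ofReal_mul (by
          have := hb k
          have := hr.1
          positivity)]
        exact ENNReal.ofReal_le_ofReal (hj1 k))
    refine ⟨M, hM0, hj2, hj3, ?_⟩
    rw [volumeMean_eq_lintegral hq hhol hr]
    set P := ∫⁻ z, ‖monomialSeries i q n b ((r : ℂ) • z)‖ₑ ^ q ∂normalizedVolume d with hP
    have hMq : ENNReal.ofReal M ^ q = ENNReal.ofReal (M ^ q) :=
      ENNReal.ofReal_rpow_of_nonneg hM0 hq.le
    rw [hMq] at hup hlow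
    have hPtop : P ≠ ⊤ := (hup.trans_lt (ENNReal.mul_lt_top hG.lt_top ENNReal.ofReal_lt_top)).ne
    have hroot : ∀ {x y : ℝ}, 0 ≤ x → 0 ≤ y → (x * y ^ q) ^ (1 / q) = x ^ (1 / q) * y := by
      intro x y hx hy
      rw [Real.mul_rpow hx (by positivity), ← Real.rpow_mul hy, mul_one_div_cancel hq.ne',
        Real.rpow_one]
    have hMq0 : 0 ≤ M ^ q := by positivity
    constructor
    · have h1 := ENNReal.toReal_mono (ENNReal.mul_ne_top hG ENNReal.ofReal_ne_top) hup
      rw [ENNReal.toReal_mul, ENNReal.toReal_ofReal hMq0] at h1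
      rw [← hroot ENNReal.toReal_nonneg hM0]
      exact Real.rpow_le_rpow ENNReal.toReal_nonneg h1 (by positivity)
    · have h1 : ENNReal.ofReal (M ^ q) ≤ 2 * (3 ^ q * (2 * P)) := by
        refine le_trans ?_ hlow
        refine le_mul_of_one_le_left' ?_
        exact ENNReal.one_le_rpow (by norm_num) hq
      have h2 := ENNReal.toReal_mono (ENNReal.mul_ne_top (by norm_num)
        (ENNReal.mul_ne_top h3q (ENNReal.mul_ne_top (by norm_num) hPtop))) h1
      rw [ENNReal.toReal_ofReal hMq0, ENNReal.toReal_mul, ENNReal.toReal_mul, ENNReal.toReal_mul,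
        ← ENNReal.toReal_rpow, ENNReal.toReal_ofNat, ENNReal.toReal_ofNat] at h2
      rw [← Real.mul_rpow (by positivity) ENNReal.toReal_nonneg]
      have h3 : M ^ q ≤ 4 * 3 ^ q * P.toReal := by linarith
      calc M = (M ^ q) ^ (1 / q) := by
            rw [← Real.rpow_mul hM0, mul_one_div_cancel hq.ne', Real.rpow_one]
        _ ≤ _ := Real.rpow_le_rpow hMq0 h3 (by positivity)
  set G := (geomConst q).toReal ^ (1 / q) with hGdef
  have hG0 : 0 ≤ G := by positivity
  have hL0 : (0 : ℝ) < (4 * 3 ^ q) ^ (1 / q) := by positivity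
  refine EquivalentOn.of_le (C := (G + 1) * C) (D := C * (4 * 3 ^ q) ^ (1 / q))
    (by positivity) (by positivity) (fun r hr => ?_) fun r hr => ?_
  · obtain ⟨M, hM0, h1, h2, h3, h4⟩ := hmain r hr
    calc _ ≤ G * M := h3
      _ ≤ (G + 1) * M := by gcongr; linarith
      _ ≤ (G + 1) * (C * v r) := by gcongr
      _ = _ := by ring
  · obtain ⟨M, hM0, h1, h2, h3, h4⟩ := hmain r hr
    calc _ ≤ C * M := h2
      _ ≤ C * ((4 * 3 ^ q) ^ (1 / q) * volumeMean d q (monomialSeries i q n b) r) := by gcongr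
      _ = _ := (mul_assoc _ _ _).symm

theorem corollary1p2 (d : ℕ) (hd : 1 ≤ d) (q : ℝ) (hq : 0 < q) (w : ℝ → ℝ) (hw : IsWeight w) :
    (∃ v : ℝ → ℝ, IsLogConvexWeight v ∧ EquivalentOn (Set.Ico 0 1) w v) ↔
      ∃ f : CSpace d → ℂ, IsHolomorphicOnBall d f ∧
        EquivalentOn (Set.Ioo 0 1) (volumeMean d q f) w := by
  constructor
  · rintro ⟨v, hv, hwv⟩
    have hvw := hwv.symm.mono Set.Ioo_subset_Ico_self
    obtain ⟨f, hf, hfv⟩ : ∃ f : CSpace d → ℂ, IsHolomorphicOnBall d f ∧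
        EquivalentOn (Set.Ioo 0 1) (volumeMean d q f) v := by
      -- The supporting-line construction needs Φ unbounded; a bounded weight is comparable to a
      -- constant.
      by_cases hbdd : ∃ K, ∀ r ∈ Set.Ico (0 : ℝ) 1, v r ≤ K
      · obtain ⟨K, hK⟩ := hbdd
        exact exists_volumeMean_equivalent_of_bounded d q hv.toIsWeight hK
      · push Not at hbdd
        exact exists_volumeMean_equivalent_of_unbounded ⟨0, hd⟩ hq hv hbdd
    exact ⟨f, hf, hfv.trans hvw⟩
  · rintro ⟨f, hf, h⟩
    exact exists_logConvex_of_volumeMean hq hw hf h
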